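/- For every $\varepsilon>0$ let $u=u_\varepsilon$ be a solution on $[1,\infty)$ of the boundary value problem $$u''+\frac1r\,u'+\varepsilon\,u\,u'=0,\qquad u(1)=0,\qquad \lim_{r\to\infty}u(r)=1 ,$$ that is, of Lagerstrom's problem $u''+\frac{n-1}{r}u'+\varepsilon uu'+ku'^2=0$ with $k=0$, $n=2$. Write $\lambda=\log(1/\varepsilon)$, let $\gamma$ be the Euler–Mascheroni constant and $E_1(\rho)=\int_\rho^\infty \tau^{-1}e^{-\tau}\,d\tau$ for $\rho>0$. Then for each $\varepsilon>0$ there is exactly one constant $C=C(\varepsilon)$ such that, in terms of the variable $\rho=\varepsilon r$ (so that $u(\rho)$ stands for $u_\varepsilon(\rho/\varepsilon)$), $$u(\rho)-1=C\int_\infty^\rho \frac{e^{-\tau}}{\tau}\,\exp\Bigl(-\int_\infty^\tau (u(\sigma)-1)\,d\sigma\Bigr)\,d\tau\qquad\text{for all }\rho\ge\varepsilon,$$ all the integrals being convergent. As $\varepsilon\to0^+$, $$C=\frac1\lambda+\frac{\gamma+1}{\lambda^2}+\frac{\gamma^2+2\gamma+\frac12-\log2}{\lambda^3}+O(\lambda^{-4}).$$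 For each fixed $r\ge1$ (inner expansion), as $\varepsilon\to0^+$, $$u_\varepsilon(r)=\frac{\log r}{\lambda}+\frac{\gamma\log r}{\lambda^2}+O(\lambda^{-3}).$$ For each fixed $\rho>0$ (outer expansion), as $\varepsilon\to0^+$, $$u_\varepsilon(\rho/\varepsilon)-1=-E_1(\rho)\Bigl(\frac1\lambda+\frac{\gamma+1}{\lambda^2}\Bigr)+\frac1{\lambda^2}\Bigl(2E_1(2\rho)-e^{-\rho}E_1(\rho)\Bigr)+O(\lambda^{-3}).$$ -/

import Mathlib

open Set Filter Topology MeasureTheory Asymptotics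

/-- `u` (only its values on `[1, ∞)` matter) is a twice differentiable solution on `[1, ∞)` of
`u'' + ((n - 1) / r) u' + ε u u' + k (u')² = 0` with `u(1) = 0` and `u(∞) = 1`.
Derivatives at the end point `r = 1` are one-sided; `v` and `w` are the first and second
derivatives of `u`. -/
def IsLagerstromSolution (n k ε : ℝ) (u : ℝ → ℝ) : Prop :=
  (∃ v w : ℝ → ℝ,
    (∀ r, 1 ≤ r → HasDerivWithinAt u (v r) (Ici 1) r) ∧
    (∀ r, 1 ≤ r → HasDerivWithinAt v (w r) (Ici 1) r) ∧
    ∀ r, 1 ≤ r → w r + (n - 1) / r * v r + ε * u r * v r + k * (v r) ^ 2 = 0) ∧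
  u 1 = 0 ∧ Tendsto u atTop (𝓝 1)

/-- The exponential integral `E₁(ρ) = ∫_ρ^∞ e^{-τ} / τ dτ` (used for `ρ > 0`). -/
noncomputable def expIntE1 (ρ : ℝ) : ℝ :=
  ∫ τ in Ioi ρ, Real.exp (-τ) / τ

/-- The integrand `τ⁻¹ e^{-τ} exp(-∫_∞^τ (u - 1) dσ)`, where `u` is regarded as a function of the
outer variable `σ = ε r`; note that `-∫_∞^τ (u - 1) dσ = ∫_τ^∞ (u - 1) dσ`. -/
noncomputable def outerKernel (ε : ℝ) (u : ℝ → ℝ) (τ : ℝ) : ℝ :=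
  Real.exp (-τ) / τ * Real.exp (∫ σ in Ioi τ, (u (σ / ε) - 1))

/-- `c` is the constant in the integral equation (case `k = 0`, `n = 2`)
`u(ρ) - 1 = c ∫_∞^ρ τ⁻¹ e^{-τ} exp(-∫_∞^τ (u - 1) dσ) dτ` for all `ρ ≥ ε`,
in the outer variable `ρ = ε r`, all the integrals being convergent. At `ρ = ε`, where `u`
vanishes, the equation reads `-1 = c ∫_∞^ε …`. -/
def IsIntegralEqConstant (ε : ℝ) (u : ℝ → ℝ) (c : ℝ) : Prop :=
  IntegrableOn (fun σ => u (σ / ε) - 1) (Ioi ε) ∧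
  IntegrableOn (outerKernel ε u) (Ioi ε) ∧
  ∀ ρ, ε ≤ ρ → u (ρ / ε) - 1 = c * (-∫ τ in Ioi ρ, outerKernel ε u τ)

/-! In the outer variable `ρ = ε r`, with `W = 1 - u` and `Φ(τ) = ∫_τ^∞ W`, a first integral turns
the equation into the system `W' = -C e^{-τ} e^{-Φ} / τ`, `Φ' = -W`, with both unknowns vanishing at
infinity and `W(ε) = 1`. That `Φ` converges rests on the energy inequality `W ≤ 2 u'`
(`exists_outerSystem_of_hasDerivAt`).

Comparing derivatives from infinity inwards bounds the two unknowns alternately: `Φ ≥ 0` gives `W ≤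
C E₁`, this bounds `Φ` above, which bounds `W` below, and so on. The iterated integrals that arise
are elementary in `E₁`, and a few rounds determine `Φ` up to `O(C³)` and `W` up to `O(C³ E₁)`.

At `ρ = ε` the second error is one order too large for `C`, since `E₁(ε) ~ λ`. Integration by parts
(`remainder_mem`) gives instead `1 / C = E₁(ε) e^{-Φ(ε)} + ∫_ε^∞ E₁ W e^{-Φ}`, where `Φ(ε)` up to
`O(C³)` and the leading term `2 C log 2` of the integral suffice. With `E₁(ε) = λ - γ + O(ε)` this
is an algebraic relation for `C`, inverted in powers of `1 / λ` by `exists_expansion`. The outer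
expansion follows by substituting `C` into the bounds on `W`, the inner one from `u ≈ C e^{-Φ(ε)}
log r`. -/

/-- A function on `[a, ∞)` which is antitone in the differential sense and tends to `0` at infinity
is nonnegative; here in the form of a comparison of two functions. -/
theorem le_of_hasDerivAt_le_of_tendsto_zero {a : ℝ} {f g f' g' : ℝ → ℝ}
    (hf : ContinuousOn f (Ici a)) (hg : ContinuousOn g (Ici a))
    (hf' : ∀ x, a < x → HasDerivAt f (f' x) x) (hg' : ∀ x, a < x → HasDerivAt g (g' x) x)
    (h : ∀ x, a < x → g' x ≤ f' x)
    (hf0 : Tendsto f atTop (𝓝 0)) (hg0 : Tendsto g atTop (𝓝 0)) {x : ℝ} (hx : a ≤ x) :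
    f x ≤ g x := by
  have hanti : AntitoneOn (fun t => g t - f t) (Ici a) := by
    refine antitoneOn_of_deriv_nonpos (convex_Ici a) (hg.sub hf) ?_ ?_
    · rw [interior_Ici]
      exact fun t ht => ((hg' t ht).sub (hf' t ht)).differentiableAt.differentiableWithinAt
    · rw [interior_Ici]
      intro t ht
      have := ((hg' t ht).sub (hf' t ht)).deriv
      have h2 := h t ht
      change deriv (g - f) t ≤ 0
      linarith
  have hlim : Tendsto (fun t => g t - f t) atTop (𝓝 0) := by simpa using hg0.sub hf0
  have : 0 ≤ g x - f x := by
    refine le_of_tendsto hlim ?_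
    filter_upwards [eventually_ge_atTop x] with t ht
    exact hanti hx (hx.trans ht) ht
  linarith

/-! ### Tail integrals as functions of their lower limit -/

section Tail

variable {a : ℝ} {f : ℝ → ℝ}

theorem integral_Ioi_eq_sub (hf : IntegrableOn f (Ioi a)) {x : ℝ} (hx : a ≤ x) :
    ∫ t in Ioi x, f t = (∫ t in Ioi a, f t) - ∫ t in a..x, f t := by
  have := intervalIntegral.integral_interval_add_Ioi hf (hf.mono_set (Ioi_subset_Ioi hx))
  linarith

theorem hasDerivAt_integral_Ioi (hf : IntegrableOn f (Ioi a)) {x : ℝ} (hx : a < x)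
    (hc : ContinuousAt f x) : HasDerivAt (fun t => ∫ s in Ioi t, f s) (-f x) x := by
  have hi : IntervalIntegrable f volume a x :=
    (intervalIntegrable_iff_integrableOn_Ioc_of_le hx.le).2 (hf.mono_set Ioc_subset_Ioi_self)
  have h1 := intervalIntegral.integral_hasDerivAt_right hi
    ⟨Ioi a, Ioi_mem_nhds hx, hf.aestronglyMeasurable⟩ hc
  have h2 := h1.const_sub (∫ t in Ioi a, f t)
  refine h2.congr_of_eventuallyEq ?_
  filter_upwards [Ioi_mem_nhds hx] with t ht
  exact integral_Ioi_eq_sub hf (le_of_lt ht)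

theorem continuousOn_integral_Ioi (hf : IntegrableOn f (Ioi a)) :
    ContinuousOn (fun t => ∫ s in Ioi t, f s) (Ici a) := by
  intro x hx
  have h1 : ContinuousOn (fun t => ∫ s in a..t, f s) (uIcc a (x + 1)) := by
    refine intervalIntegral.continuousOn_primitive_interval ?_
    rw [uIcc_of_le (by linarith [mem_Ici.1 hx]), integrableOn_Icc_iff_integrableOn_Ioc]
    exact hf.mono_set Ioc_subset_Ioi_self
  rw [uIcc_of_le (by linarith [mem_Ici.1 hx])] at h1
  have h2 : ContinuousWithinAt (fun t => ∫ s in a..t, f s) (Ici a) x := by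
    refine (h1 x ⟨hx, by linarith⟩).mono_of_mem_nhdsWithin ?_
    exact mem_nhdsWithin.2 ⟨Iio (x + 1), isOpen_Iio, by simp, fun t ht => ⟨ht.2, le_of_lt ht.1⟩⟩
  have h3 : ContinuousWithinAt (fun t => (∫ s in Ioi a, f s) - ∫ s in a..t, f s) (Ici a) x :=
    continuousWithinAt_const.sub h2
  exact h3.congr (fun t ht => integral_Ioi_eq_sub hf ht) (integral_Ioi_eq_sub hf hx)

theorem tendsto_integral_Ioi_zero (hf : IntegrableOn f (Ioi a)) :
    Tendsto (fun t => ∫ s in Ioi t, f s) atTop (𝓝 0) := by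
  have h1 := intervalIntegral_tendsto_integral_Ioi a hf tendsto_id
  have h2 := h1.const_sub (∫ t in Ioi a, f t)
  rw [sub_self] at h2
  refine h2.congr' ?_
  filter_upwards [eventually_ge_atTop a] with t ht
  exact (integral_Ioi_eq_sub hf ht).symm

end Tail

/-! ### The exponential integral and its logarithmic singularity at zero -/

section ExpInt

theorem integrableOn_exp_neg_div {a : ℝ} (ha : 0 < a) :
    IntegrableOn (fun t => Real.exp (-t) / t) (Ioi a) := by
  have h := (integrableOn_exp_neg_Ioi a).div_const a
  refine Integrable.mono' h ?_ ?_
  · refine ContinuousOn.aestronglyMeasurable (fun t ht => ?_) measurableSet_Ioi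
    have : t ≠ 0 := (ha.trans ht).ne'
    fun_prop (disch := assumption)
  · refine (ae_restrict_iff' measurableSet_Ioi).2 (Eventually.of_forall fun t ht => ?_)
    have h0 : 0 < t := ha.trans ht
    rw [Real.norm_of_nonneg (by positivity)]
    have : a ≤ t := le_of_lt ht
    gcongr

theorem hasDerivAt_expIntE1 {x : ℝ} (hx : 0 < x) :
    HasDerivAt expIntE1 (-(Real.exp (-x) / x)) x :=
  hasDerivAt_integral_Ioi (integrableOn_exp_neg_div (half_pos hx)) (by linarith)
    (by have := hx.ne'; fun_prop (disch := assumption))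

theorem tendsto_expIntE1_atTop : Tendsto expIntE1 atTop (𝓝 0) :=
  tendsto_integral_Ioi_zero (integrableOn_exp_neg_div one_pos)

theorem tendsto_exp_neg_atTop : Tendsto (fun x : ℝ => Real.exp (-x)) atTop (𝓝 0) :=
  Real.tendsto_exp_neg_atTop_nhds_zero

theorem expIntE1_nonneg {x : ℝ} (hx : 0 < x) : 0 ≤ expIntE1 x :=
  setIntegral_nonneg measurableSet_Ioi fun t ht => by
    have : 0 < t := hx.trans ht
    positivity

/-- Comparison of two functions on `(0, ∞)` that are differentiable and tend to `0` at infinity. -/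
theorem le_of_hasDerivAt_le_of_pos {f g f' g' : ℝ → ℝ}
    (hf' : ∀ x, 0 < x → HasDerivAt f (f' x) x) (hg' : ∀ x, 0 < x → HasDerivAt g (g' x) x)
    (h : ∀ x, 0 < x → g' x ≤ f' x)
    (hf0 : Tendsto f atTop (𝓝 0)) (hg0 : Tendsto g atTop (𝓝 0)) {x : ℝ} (hx : 0 < x) :
    f x ≤ g x :=
  le_of_hasDerivAt_le_of_tendsto_zero
    (fun t ht => (hf' t (hx.trans_le ht)).continuousAt.continuousWithinAt)
    (fun t ht => (hg' t (hx.trans_le ht)).continuousAt.continuousWithinAt)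
    (fun t ht => hf' t (hx.trans ht)) (fun t ht => hg' t (hx.trans ht))
    (fun t ht => h t (hx.trans ht)) hf0 hg0 le_rfl

theorem expIntE1_le {x : ℝ} (hx : 0 < x) : x * expIntE1 x ≤ Real.exp (-x) := by
  have h : expIntE1 x ≤ Real.exp (-x) / x := by
    have h1 : ∫ t in Ioi x, Real.exp (-t) / x = Real.exp (-x) / x := by
      rw [integral_div, integral_exp_neg_Ioi]
    rw [← h1]
    refine setIntegral_mono_on (integrableOn_exp_neg_div hx)
      ((integrableOn_exp_neg_Ioi x).div_const x) measurableSet_Ioi fun t ht => ?_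
    have : x ≤ t := le_of_lt ht
    gcongr
  rw [le_div_iff₀ hx] at h
  linarith

theorem tendsto_mul_expIntE1_atTop : Tendsto (fun x => x * expIntE1 x) atTop (𝓝 0) := by
  refine squeeze_zero' ?_ ?_ tendsto_exp_neg_atTop
  · filter_upwards [eventually_gt_atTop 0] with x hx
    exact mul_nonneg hx.le (expIntE1_nonneg hx)
  · filter_upwards [eventually_gt_atTop 0] with x hx
    exact expIntE1_le hx

/-- This is `Γ'(1) = -γ`, with Euler's integral differentiated under the integral sign. -/
theorem integral_log_mul_exp_neg :
    IntegrableOn (fun t => Real.exp (-t) * Real.log t) (Ioi 0) ∧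
    ∫ t in Ioi (0 : ℝ), Real.exp (-t) * Real.log t = -Real.eulerMascheroniConstant := by
  have h1 := Complex.hasDerivAt_GammaIntegral (s := 1) (by simp)
  have h2 : HasDerivAt Complex.Gamma (-Real.eulerMascheroniConstant : ℂ) 1 :=
    Complex.hasDerivAt_Gamma_one
  have h3 : Complex.Gamma =ᶠ[𝓝 1] Complex.GammaIntegral := by
    have : {s : ℂ | 0 < s.re} ∈ 𝓝 (1 : ℂ) :=
      (isOpen_lt continuous_const Complex.continuous_re).mem_nhds (by simp)
    filter_upwards [this] with s hs
    exact Complex.Gamma_eq_integral hs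
  have h4 := (h2.congr_of_eventuallyEq h3.symm).unique h1
  have h5 : ∫ t in Ioi (0 : ℝ), ((Real.exp (-t) * Real.log t : ℝ) : ℂ)
      = ((-Real.eulerMascheroniConstant : ℝ) : ℂ) := by
    push_cast
    rw [h4]
    refine setIntegral_congr_fun measurableSet_Ioi fun t ht => ?_
    simp [mul_comm]
  rw [integral_complex_ofReal] at h5
  have h6 : ∫ t in Ioi (0 : ℝ), Real.exp (-t) * Real.log t = -Real.eulerMascheroniConstant := by
    exact_mod_cast h5
  refine ⟨?_, h6⟩
  -- A divergent integral has the default value `0`, whereas `-γ ≠ 0`.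
  by_contra hcon
  rw [integral_undef hcon] at h6
  linarith [Real.one_half_lt_eulerMascheroniConstant]

theorem tendsto_exp_neg_mul_log_atTop :
    Tendsto (fun x : ℝ => Real.exp (-x) * Real.log x) atTop (𝓝 0) := by
  have h : Tendsto (fun x : ℝ => x ^ (1 : ℕ) * Real.exp (-x)) atTop (𝓝 0) :=
    Real.tendsto_pow_mul_exp_neg_atTop_nhds_zero 1
  refine squeeze_zero' ?_ ?_ h
  · filter_upwards [eventually_ge_atTop 1] with x hx
    exact mul_nonneg (Real.exp_pos _).le (Real.log_nonneg hx)
  · filter_upwards [eventually_ge_atTop 1] with x hx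
    rw [pow_one, mul_comm]
    gcongr
    exact (Real.log_le_sub_one_of_pos (by linarith)).trans (by linarith)

/-- Integration by parts; `e^{-x} log x` is the boundary term. -/
theorem expIntE1_add_log_eq {x : ℝ} (hx : 0 < x) :
    expIntE1 x + Real.exp (-x) * Real.log x = ∫ t in Ioi x, Real.exp (-t) * Real.log t := by
  have hd : ∀ y ∈ Ici x, HasDerivAt (fun y => expIntE1 y + Real.exp (-y) * Real.log y)
      (-(Real.exp (-y) * Real.log y)) y := by
    intro y hy
    have hy0 : 0 < y := hx.trans_le hy
    have h := (hasDerivAt_expIntE1 hy0).add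
      ((hasDerivAt_neg y).exp.mul (Real.hasDerivAt_log hy0.ne'))
    refine h.congr_deriv ?_
    field_simp
    ring
  have h := integral_Ioi_of_hasDerivAt_of_tendsto' hd
    (integral_log_mul_exp_neg.1.mono_set (Ioi_subset_Ioi hx.le)).neg
    (by simpa using tendsto_expIntE1_atTop.add tendsto_exp_neg_mul_log_atTop)
  rw [integral_neg] at h
  linarith

theorem tendsto_expIntE1_add_log :
    Tendsto (fun x => expIntE1 x + Real.log x) (𝓝[>] 0) (𝓝 (-Real.eulerMascheroniConstant)) := by
  have h1 : Tendsto (fun x => ∫ t in Ioi x, Real.exp (-t) * Real.log t) (𝓝[>] (0 : ℝ))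
      (𝓝 (-Real.eulerMascheroniConstant)) := by
    rw [← integral_log_mul_exp_neg.2]
    exact ((continuousOn_integral_Ioi integral_log_mul_exp_neg.1) 0 self_mem_Ici).mono_left
      (nhdsWithin_mono _ Ioi_subset_Ici_self)
  have h2 : Tendsto (fun x : ℝ => (1 - Real.exp (-x)) * Real.log x) (𝓝[>] 0) (𝓝 0) := by
    have h3 : Tendsto (fun x : ℝ => -(Real.log x * x)) (𝓝[>] 0) (𝓝 0) := by
      simpa using (tendsto_log_mul_rpow_nhdsGT_zero one_pos).neg
    refine squeeze_zero_norm' ?_ (a := fun x : ℝ => -(Real.log x * x)) h3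
    filter_upwards [Ioo_mem_nhdsGT (one_pos : (0 : ℝ) < 1)] with x hx
    have hl : Real.log x ≤ 0 := Real.log_nonpos hx.1.le hx.2.le
    have h4 := Real.add_one_le_exp (-x)
    have h5 : Real.exp (-x) ≤ 1 := Real.exp_le_one_iff.2 (by linarith [hx.1])
    rw [Real.norm_eq_abs, abs_mul, abs_of_nonneg (by linarith), abs_of_nonpos hl]
    nlinarith
  have h := h1.add h2
  rw [add_zero] at h
  refine h.congr' ?_
  filter_upwards [self_mem_nhdsWithin] with x hx
  rw [← expIntE1_add_log_eq hx]
  ring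

/-- `E₁(x) = -log x - γ + O(x)`, with explicit constants. -/
theorem expIntE1_add_log_mem {x : ℝ} (hx : 0 < x) :
    expIntE1 x + Real.log x + Real.eulerMascheroniConstant ∈ Icc 0 x := by
  set g : ℝ → ℝ := fun x => expIntE1 x + Real.log x + Real.eulerMascheroniConstant with hg
  -- The derivative lies in `[0, 1]` and `g` tends to `0` at `0`, so `g` increases and `g y - y`
  -- decreases from the limit `0`.
  have hd : ∀ y, 0 < y → HasDerivAt g ((1 - Real.exp (-y)) / y) y := by
    intro y hy
    have h := ((hasDerivAt_expIntE1 hy).add (Real.hasDerivAt_log hy.ne')).add_const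
      Real.eulerMascheroniConstant
    refine h.congr_deriv ?_
    field_simp
    ring
  have hlim : Tendsto g (𝓝[>] 0) (𝓝 0) := by
    simpa using tendsto_expIntE1_add_log.add_const Real.eulerMascheroniConstant
  have hm : MonotoneOn g (Ioi 0) := by
    refine monotoneOn_of_deriv_nonneg (convex_Ioi 0)
      (fun y hy => (hd y hy).continuousAt.continuousWithinAt) ?_ ?_
    · rw [interior_Ioi]
      exact fun y hy => (hd y hy).differentiableAt.differentiableWithinAt
    · rw [interior_Ioi]
      intro y hy
      rw [(hd y hy).deriv]
      have : Real.exp (-y) ≤ 1 := Real.exp_le_one_iff.2 (by linarith [mem_Ioi.1 hy])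
      exact div_nonneg (by linarith) (le_of_lt hy)
  have ha : AntitoneOn (fun y => g y - y) (Ioi 0) := by
    have hd' : ∀ y, 0 < y → HasDerivAt (fun y => g y - y) ((1 - Real.exp (-y)) / y - 1) y :=
      fun y hy => (hd y hy).sub (hasDerivAt_id y)
    refine antitoneOn_of_deriv_nonpos (convex_Ioi 0)
      (fun y hy => (hd' y hy).continuousAt.continuousWithinAt) ?_ ?_
    · rw [interior_Ioi]
      exact fun y hy => (hd' y hy).differentiableAt.differentiableWithinAt
    · rw [interior_Ioi]
      intro y hy
      rw [(hd' y hy).deriv, sub_nonpos, div_le_one hy]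
      linarith [Real.add_one_le_exp (-y)]
  have hlim' : Tendsto (fun y => g y - y) (𝓝[>] 0) (𝓝 0) := by
    have : Tendsto (fun y : ℝ => y) (𝓝[>] 0) (𝓝 0) := nhdsWithin_le_nhds
    simpa using hlim.sub this
  constructor
  · refine le_of_tendsto hlim ?_
    filter_upwards [Ioo_mem_nhdsGT hx] with y hy
    exact hm hy.1 hx hy.2.le
  · have : g x - x ≤ 0 := by
      refine ge_of_tendsto hlim' ?_
      filter_upwards [Ioo_mem_nhdsGT hx] with y hy
      exact ha hy.1 hx hy.2.le
    change g x ≤ x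
    linarith

end ExpInt

/-! ### Iterated integrals of `E₁` in closed form, and their limits at zero -/

/-- `∫_x^∞ E₁`. -/
noncomputable def expIntG (x : ℝ) : ℝ := Real.exp (-x) - x * expIntE1 x

/-- `∫_x^∞ τ⁻¹ e^{-τ} G(τ) dτ` with `G = expIntG`. -/
noncomputable def expIntH (x : ℝ) : ℝ := 2 * expIntE1 (2 * x) - Real.exp (-x) * expIntE1 x

/-- `∫_x^∞ e^{-τ} E₁(τ) dτ`. -/
noncomputable def expIntB (x : ℝ) : ℝ := Real.exp (-x) * expIntE1 x - expIntE1 (2 * x)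

/-- `∫_x^∞ H` with `H = expIntH`. -/
noncomputable def expIntJ (x : ℝ) : ℝ := expIntG (2 * x) - expIntB x

/-- `∫_x^∞ E₁²`. -/
noncomputable def expIntD (x : ℝ) : ℝ := 2 * expIntB x - x * expIntE1 x * expIntE1 x

theorem hasDerivAt_exp_neg (x : ℝ) :
    HasDerivAt (fun x : ℝ => Real.exp (-x)) (-Real.exp (-x)) x :=
  (hasDerivAt_neg x).exp.congr_deriv (by ring)

theorem hasDerivAt_expIntE1_two_mul {x : ℝ} (hx : 0 < x) :
    HasDerivAt (fun x => expIntE1 (2 * x)) (-(Real.exp (-x) * Real.exp (-x) / x)) x := by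
  have h := (hasDerivAt_expIntE1 (x := 2 * x) (by linarith)).comp x
    ((hasDerivAt_id x).const_mul 2)
  refine h.congr_deriv ?_
  rw [← Real.exp_add, show -x + -x = -(2 * x) by ring]
  field_simp

theorem hasDerivAt_expIntG {x : ℝ} (hx : 0 < x) : HasDerivAt expIntG (-expIntE1 x) x := by
  have h := (hasDerivAt_exp_neg x).sub ((hasDerivAt_id x).mul (hasDerivAt_expIntE1 hx))
  refine h.congr_deriv ?_
  simp only [id]
  field_simp
  ring

theorem hasDerivAt_expIntH {x : ℝ} (hx : 0 < x) :
    HasDerivAt expIntH (-(Real.exp (-x) / x * expIntG x)) x := by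
  have h := ((hasDerivAt_expIntE1_two_mul hx).const_mul 2).sub
    ((hasDerivAt_exp_neg x).mul (hasDerivAt_expIntE1 hx))
  refine h.congr_deriv ?_
  rw [expIntG]
  field_simp
  ring

theorem hasDerivAt_expIntB {x : ℝ} (hx : 0 < x) :
    HasDerivAt expIntB (-(Real.exp (-x) * expIntE1 x)) x := by
  have h := ((hasDerivAt_exp_neg x).mul (hasDerivAt_expIntE1 hx)).sub
    (hasDerivAt_expIntE1_two_mul hx)
  refine h.congr_deriv ?_
  field_simp
  ring

theorem hasDerivAt_expIntJ {x : ℝ} (hx : 0 < x) : HasDerivAt expIntJ (-expIntH x) x := by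
  have h := ((hasDerivAt_expIntG (x := 2 * x) (by linarith)).comp x
    ((hasDerivAt_id x).const_mul 2)).sub (hasDerivAt_expIntB hx)
  refine h.congr_deriv ?_
  rw [expIntH]
  ring

theorem hasDerivAt_expIntD {x : ℝ} (hx : 0 < x) :
    HasDerivAt expIntD (-(expIntE1 x * expIntE1 x)) x := by
  have h := ((hasDerivAt_expIntB hx).const_mul 2).sub
    (((hasDerivAt_id x).mul (hasDerivAt_expIntE1 hx)).mul (hasDerivAt_expIntE1 hx))
  refine h.congr_deriv ?_
  simp only [id, Pi.mul_apply]
  field_simp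
  ring

theorem tendsto_two_mul_atTop : Tendsto (fun x : ℝ => 2 * x) atTop atTop :=
  tendsto_id.const_mul_atTop two_pos

theorem tendsto_expIntG_atTop : Tendsto expIntG atTop (𝓝 0) := by
  simpa using! tendsto_exp_neg_atTop.sub tendsto_mul_expIntE1_atTop

theorem tendsto_expIntB_atTop : Tendsto expIntB atTop (𝓝 0) := by
  simpa using! (tendsto_exp_neg_atTop.mul tendsto_expIntE1_atTop).sub
    (tendsto_expIntE1_atTop.comp tendsto_two_mul_atTop)

theorem tendsto_expIntH_atTop : Tendsto expIntH atTop (𝓝 0) := by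
  simpa using! ((tendsto_expIntE1_atTop.comp tendsto_two_mul_atTop).const_mul 2).sub
    (tendsto_exp_neg_atTop.mul tendsto_expIntE1_atTop)

theorem tendsto_expIntJ_atTop : Tendsto expIntJ atTop (𝓝 0) := by
  simpa using! (tendsto_expIntG_atTop.comp tendsto_two_mul_atTop).sub tendsto_expIntB_atTop

theorem tendsto_expIntD_atTop : Tendsto expIntD atTop (𝓝 0) := by
  simpa using! (tendsto_expIntB_atTop.const_mul 2).sub
    (tendsto_mul_expIntE1_atTop.mul tendsto_expIntE1_atTop)

theorem exp_neg_le_one {x : ℝ} (hx : 0 ≤ x) : Real.exp (-x) ≤ 1 :=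
  Real.exp_le_one_iff.2 (by linarith)

theorem expIntG_nonneg {x : ℝ} (hx : 0 < x) : 0 ≤ expIntG x :=
  sub_nonneg.2 (expIntE1_le hx)

theorem expIntG_le_one {x : ℝ} (hx : 0 < x) : expIntG x ≤ 1 := by
  have := mul_nonneg hx.le (expIntE1_nonneg hx)
  have := exp_neg_le_one hx.le
  rw [expIntG]
  linarith

theorem expIntH_le {x : ℝ} (hx : 0 < x) : expIntH x ≤ expIntE1 x :=
  le_of_hasDerivAt_le_of_pos (fun _ hx => hasDerivAt_expIntH hx)
    (fun _ hx => hasDerivAt_expIntE1 hx)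
    (fun x hx => neg_le_neg (mul_le_of_le_one_right (by positivity) (expIntG_le_one hx)))
    tendsto_expIntH_atTop tendsto_expIntE1_atTop hx

theorem expIntJ_le {x : ℝ} (hx : 0 < x) : expIntJ x ≤ expIntG x :=
  le_of_hasDerivAt_le_of_pos (fun _ hx => hasDerivAt_expIntJ hx)
    (fun _ hx => hasDerivAt_expIntG hx)
    (fun _ hx => neg_le_neg (expIntH_le hx))
    tendsto_expIntJ_atTop tendsto_expIntG_atTop hx

theorem expIntE1_two_mul_le {x : ℝ} (hx : 0 < x) : expIntE1 (2 * x) ≤ expIntE1 x :=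
  setIntegral_mono_set (integrableOn_exp_neg_div hx)
    ((ae_restrict_iff' measurableSet_Ioi).2 (Eventually.of_forall fun t ht => by
      have : 0 < t := hx.trans ht
      change 0 ≤ Real.exp (-t) / t
      positivity))
    (LE.le.eventuallyLE (Ioi_subset_Ioi (by linarith)))

theorem abs_expIntG_sub_one_le {x : ℝ} (hx : 0 < x) :
    |expIntG x - 1| ≤ x + x * expIntE1 x := by
  have h1 := mul_nonneg hx.le (expIntE1_nonneg hx)
  have h2 := Real.add_one_le_exp (-x)
  have h3 := expIntG_le_one hx
  rw [abs_of_nonpos (by linarith), expIntG]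
  linarith

/-- The logarithms in `E₁(x)` and `E₁(2x)` cancel up to `log 2`; this is the source of every `log 2`
in the expansions. -/
theorem abs_expIntB_sub_log_two_le {x : ℝ} (hx : 0 < x) :
    |expIntB x - Real.log 2| ≤ 2 * x + x * expIntE1 x := by
  obtain ⟨h1, h2⟩ := expIntE1_add_log_mem hx
  obtain ⟨h3, h4⟩ := expIntE1_add_log_mem (x := 2 * x) (by linarith)
  rw [Real.log_mul two_ne_zero hx.ne'] at h3 h4
  have h5 := expIntE1_nonneg hx
  have h6 : (1 - Real.exp (-x)) * expIntE1 x ≤ x * expIntE1 x :=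
    mul_le_mul_of_nonneg_right (by linarith [Real.add_one_le_exp (-x)]) h5
  have h7 : 0 ≤ (1 - Real.exp (-x)) * expIntE1 x :=
    mul_nonneg (by linarith [exp_neg_le_one hx.le]) h5
  rw [expIntB, abs_le]
  constructor <;> linarith

theorem abs_expIntJ_sub_le {x : ℝ} (hx : 0 < x) :
    |expIntJ x - (1 - Real.log 2)| ≤ 4 * x + 3 * (x * expIntE1 x) := by
  have h1 := abs_le.1 (abs_expIntG_sub_one_le (x := 2 * x) (by linarith))
  have h2 := abs_le.1 (abs_expIntB_sub_log_two_le hx)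
  have h3 := mul_le_mul_of_nonneg_left (expIntE1_two_mul_le hx) hx.le
  rw [expIntJ, abs_le]
  constructor <;> linarith [h1.1, h1.2, h2.1, h2.2]

theorem abs_expIntD_sub_le {x : ℝ} (hx : 0 < x) :
    |expIntD x - 2 * Real.log 2| ≤
      4 * x + 2 * (x * expIntE1 x) + x * expIntE1 x * expIntE1 x := by
  have h2 := abs_le.1 (abs_expIntB_sub_log_two_le hx)
  have h5 := expIntE1_nonneg hx
  have h3 : 0 ≤ x * expIntE1 x * expIntE1 x := by positivity
  rw [expIntD, abs_le]
  constructor <;> linarith [h2.1, h2.2]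

/-- Since `(1 + x + x²/2)(1 - x + x²/2) = 1 + x⁴/4 ≥ 1`. -/
theorem exp_neg_le_quadratic {x : ℝ} (hx : 0 ≤ x) : Real.exp (-x) ≤ 1 - x + x ^ 2 / 2 := by
  have h2 := Real.quadratic_le_exp_of_nonneg hx
  rw [Real.exp_neg, inv_le_comm₀ (Real.exp_pos _) (by nlinarith)]
  refine le_trans ?_ h2
  rw [inv_le_iff_one_le_mul₀ (by nlinarith)]
  nlinarith [pow_nonneg hx 3, pow_nonneg hx 4]

/-! ### The outer system: alternating bounds for `W` and `Φ` -/

/-- The first-order system satisfied by `W = 1 - u` and `Φ(τ) = ∫_τ^∞ W` in the outer variable. -/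
structure OuterSystem (ε C : ℝ) (W Φ : ℝ → ℝ) : Prop where
  pos : 0 < ε
  C_pos : 0 < C
  continuousOn_W : ContinuousOn W (Ici ε)
  continuousOn_Φ : ContinuousOn Φ (Ici ε)
  hasDerivAt_W : ∀ x, ε < x → HasDerivAt W (-(C * (Real.exp (-x) / x * Real.exp (-Φ x)))) x
  hasDerivAt_Φ : ∀ x, ε < x → HasDerivAt Φ (-W x) x
  tendsto_W : Tendsto W atTop (𝓝 0)
  tendsto_Φ : Tendsto Φ atTop (𝓝 0)
  W_left : W ε = 1
  W_nonneg : ∀ x, ε ≤ x → 0 ≤ W x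
  W_le_one : ∀ x, ε ≤ x → W x ≤ 1
  Φ_le_two : ∀ x, ε ≤ x → Φ x ≤ 2

namespace OuterSystem

variable {ε C : ℝ} {W Φ : ℝ → ℝ} (h : OuterSystem ε C W Φ) {x : ℝ}
include h

theorem pos_of_le (hx : ε ≤ x) : 0 < x := h.pos.trans_le hx

/-- This lemma and the next three are the comparison principle for each unknown and direction; they
pass a bound on `Φ` to `W` and back. -/
theorem W_le_of {g g' : ℝ → ℝ} (hg : ∀ x, 0 < x → HasDerivAt g (g' x) x)
    (hg0 : Tendsto g atTop (𝓝 0))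
    (hle : ∀ x, ε < x → g' x ≤ -(C * (Real.exp (-x) / x * Real.exp (-Φ x)))) (hx : ε ≤ x) :
    W x ≤ g x :=
  le_of_hasDerivAt_le_of_tendsto_zero h.continuousOn_W
    (fun t ht => (hg t (h.pos_of_le ht)).continuousAt.continuousWithinAt)
    h.hasDerivAt_W (fun t ht => hg t (h.pos_of_le ht.le)) hle h.tendsto_W hg0 hx

theorem le_W_of {g g' : ℝ → ℝ} (hg : ∀ x, 0 < x → HasDerivAt g (g' x) x)
    (hg0 : Tendsto g atTop (𝓝 0))
    (hle : ∀ x, ε < x → -(C * (Real.exp (-x) / x * Real.exp (-Φ x))) ≤ g' x) (hx : ε ≤ x) :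
    g x ≤ W x :=
  le_of_hasDerivAt_le_of_tendsto_zero
    (fun t ht => (hg t (h.pos_of_le ht)).continuousAt.continuousWithinAt) h.continuousOn_W
    (fun t ht => hg t (h.pos_of_le ht.le)) h.hasDerivAt_W hle hg0 h.tendsto_W hx

theorem Φ_le_of {g g' : ℝ → ℝ} (hg : ∀ x, 0 < x → HasDerivAt g (g' x) x)
    (hg0 : Tendsto g atTop (𝓝 0)) (hle : ∀ x, ε < x → g' x ≤ -W x) (hx : ε ≤ x) :
    Φ x ≤ g x :=
  le_of_hasDerivAt_le_of_tendsto_zero h.continuousOn_Φ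
    (fun t ht => (hg t (h.pos_of_le ht)).continuousAt.continuousWithinAt)
    h.hasDerivAt_Φ (fun t ht => hg t (h.pos_of_le ht.le)) hle h.tendsto_Φ hg0 hx

theorem le_Φ_of {g g' : ℝ → ℝ} (hg : ∀ x, 0 < x → HasDerivAt g (g' x) x)
    (hg0 : Tendsto g atTop (𝓝 0)) (hle : ∀ x, ε < x → -W x ≤ g' x) (hx : ε ≤ x) :
    g x ≤ Φ x :=
  le_of_hasDerivAt_le_of_tendsto_zero
    (fun t ht => (hg t (h.pos_of_le ht)).continuousAt.continuousWithinAt) h.continuousOn_Φ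
    (fun t ht => hg t (h.pos_of_le ht.le)) h.hasDerivAt_Φ hle hg0 h.tendsto_Φ hx

theorem Φ_nonneg (hx : ε ≤ x) : 0 ≤ Φ x :=
  h.le_Φ_of (g := fun _ => 0) (fun x _ => hasDerivAt_const x 0) tendsto_const_nhds
    (fun x hx => by linarith [h.W_nonneg x hx.le]) hx

theorem W_le (hx : ε ≤ x) : W x ≤ C * expIntE1 x := by
  refine h.W_le_of (fun x hx => (hasDerivAt_expIntE1 hx).const_mul C)
    (by simpa using tendsto_expIntE1_atTop.const_mul C) (fun x hx => ?_) hx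
  have hx0 := h.pos_of_le hx.le
  have hC := h.C_pos
  rw [mul_neg]
  gcongr
  exact mul_le_of_le_one_right (by positivity) (exp_neg_le_one (h.Φ_nonneg hx.le))

/-- The crude bound `Φ ≤ 2` already forces `C = O(1 / E₁(ε))`, which makes `C` a small parameter. -/
theorem C_mul_expIntE1_le : C * expIntE1 ε ≤ Real.exp 2 := by
  have h1 : C * Real.exp (-2) * expIntE1 ε ≤ W ε := by
    refine h.le_W_of (fun x hx => (hasDerivAt_expIntE1 hx).const_mul (C * Real.exp (-2)))
      (by simpa using tendsto_expIntE1_atTop.const_mul (C * Real.exp (-2)))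
      (fun x hx => ?_) le_rfl
    have hx0 := h.pos_of_le hx.le
    have hC := h.C_pos
    have h2 := h.Φ_le_two x hx.le
    have h3 : Real.exp (-2) ≤ Real.exp (-Φ x) := Real.exp_le_exp.2 (by linarith)
    have h4 : C * Real.exp (-2) * (Real.exp (-x) / x) ≤
        C * (Real.exp (-x) / x * Real.exp (-Φ x)) := by
      rw [mul_assoc, mul_comm (Real.exp (-2))]
      gcongr
    linarith
  rw [h.W_left, Real.exp_neg] at h1
  have := Real.exp_pos 2
  field_simp at h1
  linarith

theorem Φ_le (hx : ε ≤ x) : Φ x ≤ C * expIntG x :=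
  h.Φ_le_of (fun x hx => (hasDerivAt_expIntG hx).const_mul C)
    (by simpa using tendsto_expIntG_atTop.const_mul C)
    (fun x hx => by linarith [h.W_le hx.le]) hx

/-- Here `e^{-Φ} ≥ 1 - Φ ≥ 1 - C G`, and `expIntH` is the integral of `G` against `e^{-τ} / τ`. -/
theorem le_W (hx : ε ≤ x) : C * expIntE1 x - C ^ 2 * expIntH x ≤ W x := by
  refine h.le_W_of (fun x hx => ((hasDerivAt_expIntE1 hx).const_mul C).sub
      ((hasDerivAt_expIntH hx).const_mul (C ^ 2)))
    (by simpa using! (tendsto_expIntE1_atTop.const_mul C).sub <|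
        (tendsto_expIntH_atTop.const_mul (C ^ 2))) (fun x hx => ?_) hx
  have hx0 := h.pos_of_le hx.le
  have hC := h.C_pos
  have h1 : 1 - C * expIntG x ≤ Real.exp (-Φ x) := by
    linarith [Real.add_one_le_exp (-Φ x), h.Φ_le hx.le]
  have h2 : C * (Real.exp (-x) / x) * (1 - C * expIntG x) ≤
      C * (Real.exp (-x) / x) * Real.exp (-Φ x) := by gcongr
  linarith

theorem le_Φ (hx : ε ≤ x) : C * expIntG x - C ^ 2 * expIntJ x ≤ Φ x :=
  h.le_Φ_of (fun x hx => ((hasDerivAt_expIntG hx).const_mul C).sub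
      ((hasDerivAt_expIntJ hx).const_mul (C ^ 2)))
    (by simpa using! (tendsto_expIntG_atTop.const_mul C).sub <|
        (tendsto_expIntJ_atTop.const_mul (C ^ 2)))
    (fun x hx => by linarith [h.le_W hx.le]) hx

/-- The constant is `3/2 = 1 + 1/2`: one `C²` from `C² J ≤ C²` in the lower bound for `Φ`, half of
one from `Φ² / 2`. -/
theorem exp_neg_Φ_le (hx : ε ≤ x) : Real.exp (-Φ x) ≤ 1 - C * expIntG x + 3 / 2 * C ^ 2 := by
  have hx0 := h.pos_of_le hx
  have hC := h.C_pos
  have h0 := h.Φ_nonneg hx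
  have hG0 := expIntG_nonneg hx0
  have hG1 := expIntG_le_one hx0
  have h1 := exp_neg_le_quadratic h0
  have h2 : Φ x ≤ C := (h.Φ_le hx).trans (mul_le_of_le_one_right hC.le hG1)
  have h3 : Φ x ^ 2 ≤ C ^ 2 := pow_le_pow_left₀ h0 h2 2
  have h4 : C ^ 2 * expIntJ x ≤ C ^ 2 :=
    mul_le_of_le_one_right (by positivity) ((expIntJ_le hx0).trans hG1)
  linarith [h.le_Φ hx]

theorem W_le' (hx : ε ≤ x) :
    W x ≤ C * expIntE1 x - C ^ 2 * expIntH x + 3 / 2 * C ^ 3 * expIntE1 x := by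
  refine h.W_le_of (fun x hx => (((hasDerivAt_expIntE1 hx).const_mul C).sub
      ((hasDerivAt_expIntH hx).const_mul (C ^ 2))).add
      ((hasDerivAt_expIntE1 hx).const_mul (3 / 2 * C ^ 3)))
    (by simpa using! ((tendsto_expIntE1_atTop.const_mul C).sub
        (tendsto_expIntH_atTop.const_mul (C ^ 2))).add <|
        (tendsto_expIntE1_atTop.const_mul (3 / 2 * C ^ 3))) (fun x hx => ?_) hx
  have hx0 := h.pos_of_le hx.le
  have hC := h.C_pos
  have h2 : C * (Real.exp (-x) / x) * Real.exp (-Φ x) ≤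
      C * (Real.exp (-x) / x) * (1 - C * expIntG x + 3 / 2 * C ^ 2) := by
    gcongr
    exact h.exp_neg_Φ_le hx.le
  linarith

theorem Φ_le' (hx : ε ≤ x) :
    Φ x ≤ C * expIntG x - C ^ 2 * expIntJ x + 3 / 2 * C ^ 3 * expIntG x :=
  h.Φ_le_of (fun x hx => (((hasDerivAt_expIntG hx).const_mul C).sub
      ((hasDerivAt_expIntJ hx).const_mul (C ^ 2))).add
      ((hasDerivAt_expIntG hx).const_mul (3 / 2 * C ^ 3)))
    (by simpa using! ((tendsto_expIntG_atTop.const_mul C).sub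
        (tendsto_expIntJ_atTop.const_mul (C ^ 2))).add <|
        (tendsto_expIntG_atTop.const_mul (3 / 2 * C ^ 3)))
    (fun x hx => by linarith [h.W_le' hx.le]) hx

/-- The remainder after integration by parts in `W / C = ∫ τ⁻¹ e^{-τ} e^{-Φ}`. -/
theorem remainder_mem (hx : ε ≤ x) :
    W x / C - expIntE1 x * Real.exp (-Φ x) ∈
      Icc ((C - 2 * C ^ 2) * expIntD x) (C * expIntD x) := by
  have hC := h.C_pos
  have hcont : ContinuousOn (fun x => W x / C - expIntE1 x * Real.exp (-Φ x)) (Ici ε) := by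
    refine (h.continuousOn_W.div_const C).sub (ContinuousOn.mul (fun t ht => ?_) ?_)
    · exact (hasDerivAt_expIntE1 (h.pos_of_le ht)).continuousAt.continuousWithinAt
    · exact h.continuousOn_Φ.neg.rexp
  have hD (c : ℝ) : ContinuousOn (fun x => c * expIntD x) (Ici ε) := fun t ht =>
    ((hasDerivAt_expIntD (h.pos_of_le ht)).const_mul c).continuousAt.continuousWithinAt
  have hD0 (c : ℝ) : Tendsto (fun x => c * expIntD x) atTop (𝓝 0) := by
    simpa using tendsto_expIntD_atTop.const_mul c
  have hlim : Tendsto (fun x => W x / C - expIntE1 x * Real.exp (-Φ x)) atTop (𝓝 0) := by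
    simpa using (h.tendsto_W.div_const C).sub
      (tendsto_expIntE1_atTop.mul ((Real.continuous_exp.tendsto _).comp h.tendsto_Φ.neg))
  -- The terms `e^{-x} e^{-Φ} / x` cancel, so the remainder is `∫_x^∞ E₁ W e^{-Φ}`.
  have hderiv : ∀ x, ε < x → HasDerivAt (fun x => W x / C - expIntE1 x * Real.exp (-Φ x))
      (-(expIntE1 x * (W x * Real.exp (-Φ x)))) x := by
    intro x hx
    have hx0 := h.pos_of_le hx.le
    have h1 := ((h.hasDerivAt_W x hx).div_const C).sub
      ((hasDerivAt_expIntE1 hx0).mul (h.hasDerivAt_Φ x hx).neg.exp)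
    refine h1.congr_deriv ?_
    simp only [Pi.neg_apply]
    field_simp
    ring
  constructor
  · refine le_of_hasDerivAt_le_of_tendsto_zero (hD _) hcont
      (fun x hx => (hasDerivAt_expIntD (h.pos_of_le hx.le)).const_mul _) hderiv
      (fun x hx => ?_) (hD0 _) hlim hx
    have hx0 := h.pos_of_le hx.le
    have hE := expIntE1_nonneg hx0
    -- The two losses of `C² E₁` come from `e^{-Φ} ≥ 1 - C` and from `C² H ≤ C² E₁`.
    have h1 : C * expIntE1 x - 2 * C ^ 2 * expIntE1 x ≤ W x * Real.exp (-Φ x) := by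
      have hW := h.W_nonneg x hx.le
      have hΦC : Φ x ≤ C :=
        (h.Φ_le hx.le).trans (mul_le_of_le_one_right hC.le (expIntG_le_one hx0))
      have h2 : W x * (1 - C) ≤ W x * Real.exp (-Φ x) := by
        gcongr
        linarith [Real.add_one_le_exp (-Φ x)]
      have h3 : W x * C ≤ C * expIntE1 x * C := by
        gcongr
        exact h.W_le hx.le
      have h4 : C ^ 2 * expIntH x ≤ C ^ 2 * expIntE1 x := by
        gcongr
        exact expIntH_le hx0
      linarith [h.le_W hx.le]
    have := mul_le_mul_of_nonneg_left h1 hE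
    linarith
  · refine le_of_hasDerivAt_le_of_tendsto_zero hcont (hD _) hderiv
      (fun x hx => (hasDerivAt_expIntD (h.pos_of_le hx.le)).const_mul _)
      (fun x hx => ?_) hlim (hD0 _) hx
    have hx0 := h.pos_of_le hx.le
    have hE := expIntE1_nonneg hx0
    have h1 : W x * Real.exp (-Φ x) ≤ C * expIntE1 x :=
      (mul_le_of_le_one_right (h.W_nonneg x hx.le)
        (exp_neg_le_one (h.Φ_nonneg hx.le))).trans (h.W_le hx.le)
    have := mul_le_mul_of_nonneg_left h1 hE
    linarith

/-- Near the inner boundary the solution is squeezed between multiples of a logarithm. -/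
theorem one_sub_W_mem {r : ℝ} (hr : 1 ≤ r) :
    1 - W (ε * r) ∈ Icc (C * Real.log r * (Real.exp (-(ε * r)) * Real.exp (-Φ ε)))
      (C * Real.log r * (Real.exp (ε * r) * Real.exp (-Φ ε))) := by
  have hC := h.C_pos
  have hε := h.pos
  have hεr : ε ≤ ε * r := le_mul_of_one_le_right hε.le hr
  -- Since `Φ' = -W` lies in `[-1, 0]`, `Φ` varies by at most `ε r` on this interval.
  have hanti : ∀ x ∈ Icc ε (ε * r), Φ x ≤ Φ ε ∧ Φ ε ≤ Φ x + ε * r := by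
    have h1 : AntitoneOn Φ (Ici ε) := by
      refine antitoneOn_of_deriv_nonpos (convex_Ici ε) h.continuousOn_Φ ?_ ?_
      · rw [interior_Ici]
        exact fun t ht => (h.hasDerivAt_Φ t ht).differentiableAt.differentiableWithinAt
      · rw [interior_Ici]
        intro t ht
        rw [(h.hasDerivAt_Φ t ht).deriv]
        linarith [h.W_nonneg t (le_of_lt ht)]
    have h2 : MonotoneOn (fun x => Φ x + x) (Ici ε) := by
      have hd : ∀ t, ε < t → HasDerivAt (fun x => Φ x + x) (-W t + 1) t :=
        fun t ht => (h.hasDerivAt_Φ t ht).add (hasDerivAt_id t)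
      refine monotoneOn_of_deriv_nonneg (convex_Ici ε) (h.continuousOn_Φ.add continuousOn_id) ?_ ?_
      · rw [interior_Ici]
        exact fun t ht => (hd t ht).differentiableAt.differentiableWithinAt
      · rw [interior_Ici]
        intro t ht
        rw [(hd t ht).deriv]
        linarith [h.W_le_one t (le_of_lt ht)]
    intro x hx
    refine ⟨h1 self_mem_Ici hx.1 hx.1, ?_⟩
    have := h2 self_mem_Ici (mem_Ici.2 hx.1) hx.1
    simp only at this
    linarith [hx.2]
  have hlog : Real.log (ε * r) = Real.log ε + Real.log r :=
    Real.log_mul hε.ne' (by linarith)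
  -- Comparison of `W` with `-c log x` on `[ε, ε r]`; the condition on `c` is the sign of the
  -- derivative.
  have hmono : ∀ c : ℝ, (∀ t ∈ Ioo ε (ε * r), 0 ≤ c / t - C * (Real.exp (-t) / t * Real.exp (-Φ t)))
      → 1 - W (ε * r) ≤ c * Real.log r := by
    intro c hc
    have hd : ∀ t, ε < t → HasDerivAt (fun x => c * Real.log x + W x)
        (c * t⁻¹ + -(C * (Real.exp (-t) / t * Real.exp (-Φ t)))) t := fun t ht =>
      ((Real.hasDerivAt_log (h.pos_of_le ht.le).ne').const_mul c).add (h.hasDerivAt_W t ht)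
    have h3 : MonotoneOn (fun x => c * Real.log x + W x) (Icc ε (ε * r)) := by
      refine monotoneOn_of_deriv_nonneg (convex_Icc _ _) ?_ ?_ ?_
      · refine ContinuousOn.add (fun t ht => ?_) (h.continuousOn_W.mono Icc_subset_Ici_self)
        exact ((Real.hasDerivAt_log (h.pos_of_le ht.1).ne').const_mul
          c).continuousAt.continuousWithinAt
      · rw [interior_Icc]
        exact fun t ht => (hd t ht.1).differentiableAt.differentiableWithinAt
      · rw [interior_Icc]
        intro t ht
        rw [(hd t ht.1).deriv]
        have := hc t ht
        rw [div_eq_mul_inv] at this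
        linarith
    have h4 := h3 (left_mem_Icc.2 hεr) (right_mem_Icc.2 hεr) hεr
    simp only [h.W_left, hlog] at h4
    linarith
  have hmono' : ∀ c : ℝ, (∀ t ∈ Ioo ε (ε * r), c / t - C * (Real.exp (-t) / t * Real.exp (-Φ t)) ≤ 0)
      → c * Real.log r ≤ 1 - W (ε * r) := by
    intro c hc
    have hd : ∀ t, ε < t → HasDerivAt (fun x => c * Real.log x + W x)
        (c * t⁻¹ + -(C * (Real.exp (-t) / t * Real.exp (-Φ t)))) t := fun t ht =>
      ((Real.hasDerivAt_log (h.pos_of_le ht.le).ne').const_mul c).add (h.hasDerivAt_W t ht)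
    have h3 : AntitoneOn (fun x => c * Real.log x + W x) (Icc ε (ε * r)) := by
      refine antitoneOn_of_deriv_nonpos (convex_Icc _ _) ?_ ?_ ?_
      · refine ContinuousOn.add (fun t ht => ?_) (h.continuousOn_W.mono Icc_subset_Ici_self)
        exact ((Real.hasDerivAt_log (h.pos_of_le ht.1).ne').const_mul
          c).continuousAt.continuousWithinAt
      · rw [interior_Icc]
        exact fun t ht => (hd t ht.1).differentiableAt.differentiableWithinAt
      · rw [interior_Icc]
        intro t ht
        rw [(hd t ht.1).deriv]
        have := hc t ht
        rw [div_eq_mul_inv] at this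
        linarith
    have h4 := h3 (left_mem_Icc.2 hεr) (right_mem_Icc.2 hεr) hεr
    simp only [h.W_left, hlog] at h4
    linarith
  constructor
  · have := hmono' (C * (Real.exp (-(ε * r)) * Real.exp (-Φ ε))) (fun t ht => ?_)
    · linarith
    have ht0 := h.pos_of_le ht.1.le
    have h5 : Real.exp (-(ε * r)) * Real.exp (-Φ ε) ≤ Real.exp (-t) * Real.exp (-Φ t) := by
      gcongr
      · exact ht.2.le
      · exact (hanti t ⟨ht.1.le, ht.2.le⟩).1
    have h6 : C * (Real.exp (-(ε * r)) * Real.exp (-Φ ε)) / t ≤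
        C * (Real.exp (-t) * Real.exp (-Φ t)) / t :=
      div_le_div_of_nonneg_right (mul_le_mul_of_nonneg_left h5 hC.le) ht0.le
    have h7 : C * (Real.exp (-t) * Real.exp (-Φ t)) / t =
        C * (Real.exp (-t) / t * Real.exp (-Φ t)) := by ring
    linarith
  · have := hmono (C * (Real.exp (ε * r) * Real.exp (-Φ ε))) (fun t ht => ?_)
    · linarith
    have ht0 := h.pos_of_le ht.1.le
    have h5 : Real.exp (-t) * Real.exp (-Φ t) ≤ Real.exp (ε * r) * Real.exp (-Φ ε) := by
      rw [← Real.exp_add, ← Real.exp_add, Real.exp_le_exp]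
      linarith [(hanti t ⟨ht.1.le, ht.2.le⟩).2]
    have h6 : C * (Real.exp (-t) * Real.exp (-Φ t)) / t ≤
        C * (Real.exp (ε * r) * Real.exp (-Φ ε)) / t :=
      div_le_div_of_nonneg_right (mul_le_mul_of_nonneg_left h5 hC.le) ht0.le
    have h7 : C * (Real.exp (-t) * Real.exp (-Φ t)) / t =
        C * (Real.exp (-t) / t * Real.exp (-Φ t)) := by ring
    linarith

end OuterSystem

/-! ### From the boundary value problem to the outer system -/

/-- A function whose derivative vanishes on `(a, ∞)` is constant there. -/
theorem eq_of_hasDerivAt_zero_Ioi {a : ℝ} {f : ℝ → ℝ} (hf : ∀ x, a < x → HasDerivAt f 0 x)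
    {x y : ℝ} (hx : a < x) (hy : a < y) : f x = f y :=
  isOpen_Ioi.is_const_of_deriv_eq_zero isPreconnected_Ioi
    (fun t ht => (hf t ht).differentiableAt.differentiableWithinAt)
    (fun t ht => (hf t ht).deriv) hx hy

/-- A first integral based at `ε` fixes the sign of `V`, hence `U` is monotone with values in `[0,
1]`. Only then can integrability of `1 - U` be shown and the first integral be normalised at
infinity, which produces `C`. -/
theorem exists_outerSystem_of_hasDerivAt {ε : ℝ} (hε : 0 < ε) {U V : ℝ → ℝ}
    (hUc : ContinuousOn U (Ici ε)) (hU : ∀ x, ε < x → HasDerivAt U (V x) x)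
    (hV : ∀ x, ε < x → HasDerivAt V (-(V x / x) - U x * V x) x)
    (hU0 : U ε = 0) (hU1 : Tendsto U atTop (𝓝 1)) :
    IntegrableOn (fun x => 1 - U x) (Ioi ε) ∧
    ∃ C, OuterSystem ε C (fun x => 1 - U x) (fun τ => ∫ x in Ioi τ, (1 - U x)) := by
  -- the first integral is x V(x) = A exp (-∫ U)
  set P : ℝ → ℝ := fun x => ∫ t in ε..x, U t with hP
  have hPd : ∀ x, ε < x → HasDerivAt P (U x) x := by
    intro x hx
    refine intervalIntegral.integral_hasDerivAt_right ?_ ?_ (hU x hx).continuousAt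
    · refine ContinuousOn.intervalIntegrable (hUc.mono ?_)
      rw [uIcc_of_le hx.le]
      exact Icc_subset_Ici_self
    · exact (hUc.mono Ioi_subset_Ici_self).stronglyMeasurableAtFilter isOpen_Ioi x hx
  obtain ⟨A, hA⟩ : ∃ A, ∀ x, ε < x → x * V x * Real.exp (P x) = A := by
    refine ⟨_, fun x hx => eq_of_hasDerivAt_zero_Ioi (a := ε)
      (f := fun x => x * V x * Real.exp (P x)) (fun t ht => ?_) hx (lt_add_one ε)⟩
    have ht0 : 0 < t := hε.trans ht
    have h := ((hasDerivAt_id t).mul (hV t ht)).mul (hPd t ht).exp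
    refine h.congr_deriv ?_
    simp only [id, Pi.mul_apply]
    field_simp
    ring
  have hVA : ∀ x, ε < x → V x = A / (x * Real.exp (P x)) := by
    intro x hx
    have hx0 : 0 < x := hε.trans hx
    rw [← hA x hx]
    field_simp
  have hApos : 0 < A := by
    -- With `A ≤ 0`, `U` would decrease from `0` and could not tend to `1`.
    by_contra hcon
    have hanti : AntitoneOn U (Ici ε) := by
      refine antitoneOn_of_deriv_nonpos (convex_Ici ε) hUc ?_ ?_
      · rw [interior_Ici]
        exact fun t ht => (hU t ht).differentiableAt.differentiableWithinAt
      · rw [interior_Ici]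
        intro t ht
        have ht0 : 0 < t := hε.trans ht
        rw [(hU t ht).deriv, hVA t ht]
        exact div_nonpos_of_nonpos_of_nonneg (not_lt.1 hcon) (by positivity)
    have : (1 : ℝ) ≤ 0 := by
      refine le_of_tendsto hU1 ?_
      filter_upwards [eventually_ge_atTop ε] with t ht
      rw [← hU0]
      exact hanti self_mem_Ici ht ht
    linarith
  have hVpos : ∀ x, ε < x → 0 < V x := by
    intro x hx
    have hx0 : 0 < x := hε.trans hx
    rw [hVA x hx]
    positivity
  have hmono : MonotoneOn U (Ici ε) := by
    refine monotoneOn_of_deriv_nonneg (convex_Ici ε) hUc ?_ ?_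
    · rw [interior_Ici]
      exact fun t ht => (hU t ht).differentiableAt.differentiableWithinAt
    · rw [interior_Ici]
      intro t ht
      rw [(hU t ht).deriv]
      exact (hVpos t ht).le
  have hUnonneg : ∀ x, ε ≤ x → 0 ≤ U x := fun x hx => by
    rw [← hU0]
    exact hmono self_mem_Ici hx hx
  have hUle : ∀ x, ε ≤ x → U x ≤ 1 := fun x hx => by
    refine ge_of_tendsto hU1 ?_
    filter_upwards [eventually_ge_atTop x] with t ht
    exact hmono hx (hx.trans ht) ht
  have hVlim : Tendsto V atTop (𝓝 0) := by
    have h1 : Tendsto (fun x : ℝ => A / x) atTop (𝓝 0) := tendsto_const_nhds.div_atTop tendsto_id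
    refine squeeze_zero' ?_ ?_ h1
    · filter_upwards [eventually_gt_atTop ε] with x hx
      exact (hVpos x hx).le
    · filter_upwards [eventually_gt_atTop ε] with x hx
      have hx0 : 0 < x := hε.trans hx
      rw [hVA x hx]
      have h2 : 0 ≤ P x := intervalIntegral.integral_nonneg hx.le fun t ht => hUnonneg t ht.1
      have h3 : 1 ≤ Real.exp (P x) := Real.one_le_exp h2
      gcongr
      exact le_mul_of_one_le_right hx0.le h3
  -- the energy inequality `1 - U ≤ 2 V`
  have hWV : ∀ x, ε < x → 1 - U x ≤ 2 * V x := by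
    intro x hx
    have hd : ∀ t, ε < t → HasDerivAt (fun t => V t + U t * U t / 2 - 1 / 2) (-(V t / t)) t := by
      intro t ht
      have h := ((hV t ht).add (((hU t ht).mul (hU t ht)).div_const 2)).sub_const (1 / 2)
      refine h.congr_deriv ?_
      ring
    have h0 : Tendsto (fun t => V t + U t * U t / 2 - 1 / 2) atTop (𝓝 0) := by
      simpa using (hVlim.add ((hU1.mul hU1).div_const 2)).sub_const (1 / 2)
    have h1 : 0 ≤ V x + U x * U x / 2 - 1 / 2 :=
      le_of_hasDerivAt_le_of_tendsto_zero (f := fun _ => 0) continuousOn_const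
        (fun t ht => (hd t (hx.trans_le ht)).continuousAt.continuousWithinAt)
        (fun t _ => hasDerivAt_const t 0) (fun t ht => hd t (hx.trans ht))
        (fun t ht => by
          have ht' := hx.trans ht
          have := div_nonneg (hVpos t ht').le (hε.trans ht').le
          linarith) tendsto_const_nhds h0 le_rfl
    -- From `0 ≤ U ≤ 1`: `1 - U ≤ 1 - U² ≤ 2 V`.
    nlinarith [hUnonneg x hx.le, hUle x hx.le]
  have hVint : IntegrableOn V (Ioi ε) :=
    integrableOn_Ioi_deriv_of_nonneg (hUc ε self_mem_Ici) hU (fun x hx => (hVpos x hx).le) hU1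
  have hWc : ContinuousOn (fun x => 1 - U x) (Ici ε) := continuousOn_const.sub hUc
  have hWint : IntegrableOn (fun x => 1 - U x) (Ioi ε) := by
    refine Integrable.mono' (hVint.const_mul 2)
      ((hWc.mono Ioi_subset_Ici_self).aestronglyMeasurable measurableSet_Ioi) ?_
    refine (ae_restrict_iff' measurableSet_Ioi).2 (Eventually.of_forall fun t ht => ?_)
    rw [Real.norm_of_nonneg (by linarith [hUle t (le_of_lt ht)])]
    exact hWV t ht
  refine ⟨hWint, ?_⟩
  have hWd : ∀ x, ε < x → HasDerivAt (fun x => 1 - U x) (-V x) x := fun x hx =>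
    (hU x hx).const_sub 1
  have hWlim : Tendsto (fun x => 1 - U x) atTop (𝓝 0) := by simpa using hU1.const_sub 1
  set Φ : ℝ → ℝ := fun τ => ∫ x in Ioi τ, (1 - U x) with hΦ
  have hΦd : ∀ x, ε < x → HasDerivAt Φ (-(1 - U x)) x := fun x hx =>
    hasDerivAt_integral_Ioi hWint hx (hWd x hx).continuousAt
  have hΦc : ContinuousOn Φ (Ici ε) := continuousOn_integral_Ioi hWint
  have hΦlim : Tendsto Φ atTop (𝓝 0) := tendsto_integral_Ioi_zero hWint
  -- The earlier first integral with `P` replaced by `x + Φ`; both have derivative `U`.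
  obtain ⟨C, hC⟩ : ∃ C, ∀ x, ε < x → x * V x * Real.exp (x + Φ x) = C := by
    refine ⟨_, fun x hx => eq_of_hasDerivAt_zero_Ioi (a := ε)
      (f := fun x => x * V x * Real.exp (x + Φ x)) (fun t ht => ?_) hx (lt_add_one ε)⟩
    have ht0 : 0 < t := hε.trans ht
    have h := ((hasDerivAt_id t).mul (hV t ht)).mul ((hasDerivAt_id t).add (hΦd t ht)).exp
    refine h.congr_deriv ?_
    simp only [id, Pi.mul_apply, Pi.add_apply]
    field_simp
    ring
  refine ⟨C, hε, ?_, hWc, hΦc, fun x hx => ?_, hΦd, hWlim, hΦlim, by simp [hU0],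
    fun x hx => by linarith [hUle x hx], fun x hx => by linarith [hUnonneg x hx], fun x hx => ?_⟩
  · have h1 : ε < ε + 1 := lt_add_one ε
    rw [← hC _ h1]
    have := hVpos _ h1
    positivity
  · have hx0 : 0 < x := hε.trans hx
    refine (hWd x hx).congr_deriv ?_
    rw [← hC x hx, Real.exp_add, Real.exp_neg, Real.exp_neg]
    field_simp
  -- The energy inequality compares the derivatives `-(1 - U)` and `-2 V`.
  · have h1 : Φ x ≤ 2 * (1 - U x) := by
      refine le_of_hasDerivAt_le_of_tendsto_zero hΦc
        (continuousOn_const.mul hWc : ContinuousOn (fun x => 2 * (1 - U x)) (Ici ε)) hΦd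
        (fun t ht => (hWd t ht).const_mul 2) (fun t ht => by linarith [hWV t ht]) hΦlim
        (by simpa using! hWlim.const_mul 2) hx
    linarith [hUnonneg x hx]

theorem IsLagerstromSolution.exists_outerSystem {ε : ℝ} (hε : 0 < ε) {u : ℝ → ℝ}
    (hu : IsLagerstromSolution 2 0 ε u) :
    IntegrableOn (fun x => 1 - u (x / ε)) (Ioi ε) ∧
    ∃ C, OuterSystem ε C (fun x => 1 - u (x / ε)) (fun τ => ∫ x in Ioi τ, (1 - u (x / ε))) := by
  obtain ⟨⟨v, w, hv, hw, hode⟩, hu1, hlim⟩ := hu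
  have hscale : ∀ x : ℝ, HasDerivAt (fun x => x / ε) (1 / ε) x := fun x =>
    (hasDerivAt_id x).div_const ε
  have hmaps : ∀ x, ε < x → 1 < x / ε := fun x hx => (one_lt_div hε).2 hx
  have hat : ∀ {f : ℝ → ℝ} {f' x : ℝ}, ε < x → HasDerivWithinAt f f' (Ici 1) (x / ε) →
      HasDerivAt (fun x => f (x / ε)) (f' * (1 / ε)) x := fun {f f' x} hx h =>
    (h.hasDerivAt (Ici_mem_nhds (hmaps x hx))).comp x (hscale x)
  refine exists_outerSystem_of_hasDerivAt hε (U := fun x => u (x / ε))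
    (V := fun x => v (x / ε) * (1 / ε)) ?_ (fun x hx => hat hx (hv _ (hmaps x hx).le)) ?_ ?_ ?_
  · have h1 : ContinuousOn u (Ici 1) := fun r hr => (hv r hr).continuousWithinAt
    exact h1.comp (by fun_prop) fun x hx => (one_le_div hε).2 hx
  · intro x hx
    have hx0 : 0 < x := hε.trans hx
    refine ((hat hx (hw _ (hmaps x hx).le)).mul_const (1 / ε)).congr_deriv ?_
    have h2 := hode _ (hmaps x hx).le
    have h3 : w (x / ε) = -((2 - 1) / (x / ε) * v (x / ε) + ε * u (x / ε) * v (x / ε)) := by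
      linarith
    rw [h3]
    field_simp
    ring
  · simp [hε.ne', hu1]
  · exact hlim.comp (tendsto_id.atTop_div_const hε)

/-- The kernel is `-W' / C`, so its tail integral is `W / C`. At `ρ = ε`, where `W = 1`, the
integral equation therefore forces `c = C`. -/
theorem OuterSystem.isIntegralEqConstant_iff {ε C : ℝ} {u : ℝ → ℝ}
    (hint : IntegrableOn (fun x => 1 - u (x / ε)) (Ioi ε))
    (h : OuterSystem ε C (fun x => 1 - u (x / ε)) (fun τ => ∫ x in Ioi τ, (1 - u (x / ε))))
    (c : ℝ) : IsIntegralEqConstant ε u c ↔ c = C := by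
  have hC := h.C_pos
  have hker : ∀ τ, outerKernel ε u τ =
      Real.exp (-τ) / τ * Real.exp (-∫ x in Ioi τ, (1 - u (x / ε))) := by
    intro τ
    rw [outerKernel, ← integral_neg]
    simp only [neg_sub]
  have hd : ∀ x, ε < x → HasDerivAt (fun x => -(1 - u (x / ε)) / C) (outerKernel ε u x) x := by
    intro x hx
    refine ((h.hasDerivAt_W x hx).neg.div_const C).congr_deriv ?_
    rw [hker]
    field_simp
  have hnonneg : ∀ x, ε < x → 0 ≤ outerKernel ε u x := fun x hx => by
    have := h.pos_of_le hx.le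
    rw [hker]
    positivity
  have hlim : Tendsto (fun x => -(1 - u (x / ε)) / C) atTop (𝓝 0) := by
    simpa using h.tendsto_W.neg.div_const C
  have hcont : ContinuousOn (fun x => -(1 - u (x / ε)) / C) (Ici ε) :=
    h.continuousOn_W.neg.div_const C
  have hI : ∀ x, ε ≤ x → ∫ τ in Ioi x, outerKernel ε u τ = (1 - u (x / ε)) / C := by
    intro x hx
    rw [integral_Ioi_of_hasDerivAt_of_nonneg
      ((hcont x hx).mono (Ici_subset_Ici.2 hx)) (fun t ht => hd t (hx.trans_lt ht))
      (fun t ht => hnonneg t (hx.trans_lt ht)) hlim]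
    ring
  constructor
  · rintro ⟨-, -, h3⟩
    have h4 := h3 ε le_rfl
    have h5 : u (ε / ε) = 0 := by
      linarith [show 1 - u (ε / ε) = 1 from h.W_left]
    rw [hI ε le_rfl, h5] at h4
    field_simp at h4
    linarith
  · rintro rfl
    refine ⟨?_, integrableOn_Ioi_deriv_of_nonneg (hcont ε self_mem_Ici) hd hnonneg hlim,
      fun x hx => ?_⟩
    · have := hint.neg
      exact this.congr_fun (fun x _ => neg_sub _ _) measurableSet_Ioi
    · rw [hI x hx]
      field_simp
      ring

/-! ### Calculus of bounded coefficients and inversion of the relation for `C` -/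

/-- Real-valued functions that are eventually bounded along a filter. -/
def IsBddAlong (l : Filter ℝ) (f : ℝ → ℝ) : Prop := f =O[l] fun _ => (1 : ℝ)

namespace IsBddAlong

variable {l : Filter ℝ} {f g : ℝ → ℝ}

theorem const (c : ℝ) : IsBddAlong l fun _ => c := isBigO_const_const c one_ne_zero l

theorem add (hf : IsBddAlong l f) (hg : IsBddAlong l g) : IsBddAlong l fun x => f x + g x :=
  IsBigO.add hf hg

theorem sub (hf : IsBddAlong l f) (hg : IsBddAlong l g) : IsBddAlong l fun x => f x - g x :=
  IsBigO.sub hf hg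

theorem neg (hf : IsBddAlong l f) : IsBddAlong l fun x => -f x :=
  IsBigO.neg_left hf

theorem mul (hf : IsBddAlong l f) (hg : IsBddAlong l g) : IsBddAlong l fun x => f x * g x := by
  simpa [IsBddAlong] using! IsBigO.mul hf hg

theorem pow (hf : IsBddAlong l f) (n : ℕ) : IsBddAlong l fun x => f x ^ n := by
  simpa [IsBddAlong] using! IsBigO.pow hf n

theorem of_abs_le (hg : IsBddAlong l g) (h : ∀ᶠ x in l, |f x| ≤ g x) : IsBddAlong l f :=
  (IsBigO.of_bound 1 (by
    filter_upwards [h] with x hx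
    rw [one_mul, Real.norm_eq_abs, Real.norm_eq_abs]
    exact hx.trans (le_abs_self _))).trans hg

end IsBddAlong

/-- Turns an error estimate into an exact identity with a bounded coefficient, so that expansions
can be multiplied and substituted as polynomial identities. -/
theorem exists_isBddAlong_of_abs_le {l : Filter ℝ} {δ X b : ℝ → ℝ} (n : ℕ)
    (hδ : ∀ᶠ x in l, 0 < δ x) (hb : IsBddAlong l b) (h : ∀ᶠ x in l, |X x| ≤ δ x ^ n * b x) :
    ∃ c, IsBddAlong l c ∧ ∀ᶠ x in l, X x = δ x ^ n * c x := by
  refine ⟨fun x => X x / δ x ^ n, hb.of_abs_le ?_, ?_⟩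
  · filter_upwards [hδ, h] with x hx hX
    rw [abs_div, abs_of_pos (pow_pos hx n), div_le_iff₀ (pow_pos hx n)]
    linarith
  · filter_upwards [hδ] with x hx
    field_simp

theorem abs_exp_neg_sub_quadratic_le {x : ℝ} (hx : 0 ≤ x) :
    |Real.exp (-x) - (1 - x + x ^ 2 / 2)| ≤ x ^ 3 := by
  have h1 := exp_neg_le_quadratic hx
  rw [abs_of_nonpos (by linarith)]
  rcases le_total x 1 with hx1 | hx1
  · have h2 := Real.exp_bound (x := -x) (by rwa [abs_neg, abs_of_nonneg hx]) (n := 3) (by norm_num)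
    rw [abs_le] at h2
    have h3 := h2.1
    simp only [Finset.sum_range_succ, Finset.sum_range_zero, abs_neg, abs_of_nonneg hx] at h3
    norm_num [Nat.factorial] at h3
    nlinarith [pow_nonneg hx 3]
  · have := Real.exp_pos (-x)
    nlinarith [mul_nonneg hx (sub_nonneg.2 hx1), pow_nonneg hx 3,
      mul_nonneg (mul_nonneg hx hx) (sub_nonneg.2 hx1)]

/-- Inversion of the relation between `z` and `δ` up to third order. -/
theorem exists_expansion {l : Filter ℝ} {δ z b : ℝ → ℝ} (γ κ : ℝ) (hδ : IsBddAlong l δ)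
    (hz : IsBddAlong l z) (hb : IsBddAlong l b)
    (h : ∀ᶠ x in l, z x * (1 - γ * δ x) * (1 - δ x * z x + (3 / 2 - κ) * δ x ^ 2 * z x ^ 2)
      + 2 * κ * δ x ^ 2 * z x ^ 2 - 1 = δ x ^ 3 * b x) :
    ∃ c, IsBddAlong l c ∧ ∀ᶠ x in l,
      z x = 1 + (γ + 1) * δ x + (γ ^ 2 + 2 * γ + 1 / 2 - κ) * δ x ^ 2 + δ x ^ 3 * c x := by
  set q : ℝ := 3 / 2 - κ with hq
  -- The functions `z1`, `z2`, `z3` are the successive remainders in `z = 1 + δ z1`, `z1 = γ + 1 + δ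
  -- z2`, `z2 = γ² + 2γ + 1/2 - κ + δ z3`. Written as polynomials in bounded functions, without
  -- division by `δ`, they are visibly bounded.
  obtain ⟨z1, hz1, e1⟩ : ∃ z1, IsBddAlong l z1 ∧ z1 = fun x => γ * z x + z x ^ 2 + δ x *
      (-(γ * z x ^ 2) - q * z x ^ 3 + q * γ * δ x * z x ^ 3 - 2 * κ * z x ^ 2)
      + δ x ^ 2 * b x := by
    refine ⟨_, ?_, rfl⟩
    repeat' first
      | assumption | apply IsBddAlong.const | apply IsBddAlong.pow | apply IsBddAlong.add
      | apply IsBddAlong.sub | apply IsBddAlong.neg | apply IsBddAlong.mul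
  obtain ⟨z2, hz2, e2⟩ : ∃ z2, IsBddAlong l z2 ∧ z2 = fun x => γ * z1 x + 2 * z1 x
      + δ x * z1 x ^ 2 + (-(γ * z x ^ 2) - q * z x ^ 3 + q * γ * δ x * z x ^ 3
      - 2 * κ * z x ^ 2) + δ x * b x := by
    refine ⟨_, ?_, rfl⟩
    repeat' first
      | assumption | apply IsBddAlong.const | apply IsBddAlong.pow | apply IsBddAlong.add
      | apply IsBddAlong.sub | apply IsBddAlong.neg | apply IsBddAlong.mul
  obtain ⟨z3, hz3, e3⟩ : ∃ z3, IsBddAlong l z3 ∧ z3 = fun x => (γ + 2) * z2 x + z1 x ^ 2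
      - (γ + 2 * κ) * (z1 x * (2 + δ x * z1 x))
      - q * (z1 x * (3 + 3 * δ x * z1 x + δ x ^ 2 * z1 x ^ 2)) + q * γ * z x ^ 3 + b x := by
    refine ⟨_, ?_, rfl⟩
    repeat' first
      | assumption | apply IsBddAlong.const | apply IsBddAlong.pow | apply IsBddAlong.add
      | apply IsBddAlong.sub | apply IsBddAlong.neg | apply IsBddAlong.mul
  refine ⟨z3, hz3, ?_⟩
  filter_upwards [h] with x hx
  have f1 := congrFun e1 x
  have f2 := congrFun e2 x
  have f3 := congrFun e3 x
  generalize z1 x = y1 at *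
  generalize z2 x = y2 at *
  generalize z3 x = y3 at *
  generalize z x = y at *
  generalize δ x = d at *
  generalize b x = β at *
  have g1 : y = 1 + d * y1 := by rw [f1]; linear_combination hx
  have g2 : y1 = γ + 1 + d * y2 := by
    rw [f2]
    linear_combination f1 + (γ + y + 1 + d * y1) * g1
  have g3 : y2 = γ ^ 2 + 2 * γ + 1 / 2 - κ + d * y3 := by
    rw [f3]
    linear_combination f2 + (γ + 2) * g2 - (γ + 2 * κ) * (y + 1 + d * y1) * g1
      - q * (y ^ 2 + y * (1 + d * y1) + (1 + d * y1) ^ 2) * g1 - hq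
  linear_combination g1 + d * g2 + d ^ 2 * g3

/-! ### The logarithmic gauge -/

/-- The gauge `1 / log (1 / ε)`. -/
noncomputable def logGauge (ε : ℝ) : ℝ := 1 / Real.log (1 / ε)

theorem tendsto_log_one_div : Tendsto (fun ε : ℝ => Real.log (1 / ε)) (𝓝[>] 0) atTop := by
  simp only [one_div]
  exact Real.tendsto_log_atTop.comp tendsto_inv_nhdsGT_zero

theorem tendsto_logGauge : Tendsto logGauge (𝓝[>] 0) (𝓝 0) :=
  tendsto_const_nhds.div_atTop tendsto_log_one_div

theorem logGauge_pos : ∀ᶠ ε in 𝓝[>] (0 : ℝ), 0 < logGauge ε := by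
  filter_upwards [tendsto_log_one_div.eventually_gt_atTop 0] with ε hε
  exact one_div_pos.2 hε

theorem isBddAlong_logGauge : IsBddAlong (𝓝[>] 0) logGauge :=
  tendsto_logGauge.isBigO_one ℝ

/-- `ε` is smaller than the third power of the gauge. -/
theorem exists_eq_logGauge_pow :
    ∃ a, IsBddAlong (𝓝[>] 0) a ∧ ∀ᶠ ε in 𝓝[>] (0 : ℝ), ε = logGauge ε ^ 3 * a ε := by
  refine exists_isBddAlong_of_abs_le (X := fun ε => ε) 3 logGauge_pos
    (IsBddAlong.const 6) ?_
  filter_upwards [self_mem_nhdsWithin, logGauge_pos] with ε hε hδ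
  have hε0 : (0 : ℝ) < ε := hε
  have hL : 0 < Real.log (1 / ε) := one_div_pos.1 hδ
  -- `L³ / 3! ≤ e^L = 1 / ε`, whence the constant `6`.
  have h1 : Real.log (1 / ε) ^ 3 / (Nat.factorial 3 : ℝ) ≤ Real.exp (Real.log (1 / ε)) :=
    Real.pow_div_factorial_le_exp _ hL.le 3
  rw [Real.exp_log (by positivity)] at h1
  norm_num [Nat.factorial] at h1
  rw [abs_of_pos hε0, logGauge]
  have h2 : 0 < Real.log ε⁻¹ := by simpa using hL
  have h3 : Real.log ε⁻¹ ^ 3 * ε ≤ 6 := by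
    rw [Real.log_inv]
    field_simp at h1
    linarith
  rw [one_div, one_div, inv_pow, ← div_eq_inv_mul, le_div_iff₀ (by positivity)]
  linarith

/-- Expansion of `E₁(ε)` in terms of the gauge. -/
theorem exists_expIntE1_expansion :
    ∃ a, IsBddAlong (𝓝[>] 0) a ∧ ∀ᶠ ε in 𝓝[>] (0 : ℝ), logGauge ε * expIntE1 ε =
      1 - Real.eulerMascheroniConstant * logGauge ε + logGauge ε ^ 4 * a ε := by
  obtain ⟨a, ha, hε⟩ := exists_eq_logGauge_pow
  obtain ⟨c, hc, hce⟩ := exists_isBddAlong_of_abs_le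
    (X := fun ε => expIntE1 ε + Real.log ε + Real.eulerMascheroniConstant) 3 logGauge_pos ha (by
      filter_upwards [hε, self_mem_nhdsWithin] with ε hε hpos
      obtain ⟨h1, h2⟩ := expIntE1_add_log_mem hpos
      rw [abs_of_nonneg h1, ← hε]
      exact h2)
  refine ⟨c, hc, ?_⟩
  filter_upwards [hce, logGauge_pos] with ε h1 hδ
  have h2 : logGauge ε * Real.log ε = -1 := by
    have hL : 0 < Real.log (1 / ε) := one_div_pos.1 hδ
    have h3 : Real.log (1 / ε) = -Real.log ε := by rw [one_div, Real.log_inv]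
    rw [h3] at hL
    have h4 : Real.log ε ≠ 0 := by linarith
    rw [logGauge, h3]
    field_simp
  linear_combination logGauge ε * h1 - h2

/-! ### Expansions of `C`, of the inner solution and of the outer solution -/

section Expansion

variable {C : ℝ → ℝ} {W Φ : ℝ → ℝ → ℝ}

/-- `C E₁(ε) ≤ e²`, while the gauge times `E₁(ε)` tends to `1` and so eventually exceeds `1/2`. -/
theorem exists_C_eq (h : ∀ ε, 0 < ε → OuterSystem ε (C ε) (W ε) (Φ ε)) :
    ∃ z, IsBddAlong (𝓝[>] 0) z ∧ ∀ᶠ ε in 𝓝[>] (0 : ℝ), C ε = logGauge ε ^ 1 * z ε := by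
  refine exists_isBddAlong_of_abs_le 1 logGauge_pos (IsBddAlong.const (2 * Real.exp 2)) ?_
  obtain ⟨a, ha, hE⟩ := exists_expIntE1_expansion
  have hlim : Tendsto (fun ε => logGauge ε * expIntE1 ε) (𝓝[>] 0) (𝓝 1) := by
    have h1 : Tendsto (fun ε => logGauge ε ^ 3 * (logGauge ε * a ε)) (𝓝[>] 0) (𝓝 0) := by
      have h2 : IsBddAlong (𝓝[>] 0) (fun ε => logGauge ε * a ε) := isBddAlong_logGauge.mul ha
      have h3 : Tendsto (fun ε => logGauge ε ^ 3) (𝓝[>] 0) (𝓝 0) := by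
        simpa using tendsto_logGauge.pow 3
      have h4 := ((isLittleO_one_iff ℝ).2 h3).mul_isBigO h2
      simp only [mul_one] at h4
      exact (isLittleO_one_iff ℝ).1 h4
    have h5 : Tendsto (fun ε => 1 - Real.eulerMascheroniConstant * logGauge ε
        + logGauge ε ^ 3 * (logGauge ε * a ε)) (𝓝[>] 0) (𝓝 1) := by
      simpa using ((tendsto_logGauge.const_mul Real.eulerMascheroniConstant).const_sub 1).add h1
    refine h5.congr' ?_
    filter_upwards [hE] with ε hε
    rw [hε]
    ring
  filter_upwards [self_mem_nhdsWithin, logGauge_pos,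
    hlim.eventually (eventually_gt_nhds (show (1 / 2 : ℝ) < 1 by norm_num))] with ε hε hδ hy
  have hs := h ε hε
  have hC := hs.C_pos
  have h1 := mul_le_mul_of_nonneg_left hs.C_mul_expIntE1_le hδ.le
  rw [abs_of_pos hC, pow_one]
  nlinarith

/-- As `ε = O(δ³)` and `E₁(ε) = O(1 / δ)`, with `δ` the gauge, `ε E₁(ε) = O(δ²)`. So `G(ε)` and
`J(ε)` may be replaced by their limits `1` and `1 - log 2`. -/
theorem exists_Φ_eq (h : ∀ ε, 0 < ε → OuterSystem ε (C ε) (W ε) (Φ ε)) {z : ℝ → ℝ}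
    (hz : IsBddAlong (𝓝[>] 0) z) (hC : ∀ᶠ ε in 𝓝[>] (0 : ℝ), C ε = logGauge ε ^ 1 * z ε) :
    ∃ f, IsBddAlong (𝓝[>] 0) f ∧ ∀ᶠ ε in 𝓝[>] (0 : ℝ), Φ ε ε =
      logGauge ε * z ε - (1 - Real.log 2) * logGauge ε ^ 2 * z ε ^ 2 + logGauge ε ^ 3 * f ε := by
  have hδb := isBddAlong_logGauge
  obtain ⟨a, ha, hεa⟩ := exists_eq_logGauge_pow
  obtain ⟨e, he, hE⟩ := exists_expIntE1_expansion
  obtain ⟨g, hg, hG⟩ := exists_isBddAlong_of_abs_le (X := fun ε => expIntG ε - 1) 2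
    (b := fun ε => logGauge ε * a ε + a ε *
      (1 - Real.eulerMascheroniConstant * logGauge ε + logGauge ε ^ 4 * e ε)) logGauge_pos
    (by
      repeat' first
        | assumption | apply IsBddAlong.const | apply IsBddAlong.pow | apply IsBddAlong.add
        | apply IsBddAlong.sub | apply IsBddAlong.neg | apply IsBddAlong.mul)
    (by
      filter_upwards [hεa, hE, self_mem_nhdsWithin] with ε h1 h2 hε
      refine (abs_expIntG_sub_one_le hε).trans (le_of_eq ?_)
      rw [← h2]
      linear_combination (1 + expIntE1 ε) * h1)
  obtain ⟨j, hj, hJ⟩ := exists_isBddAlong_of_abs_le (X := fun ε => expIntJ ε - (1 - Real.log 2)) 2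
    (b := fun ε => 4 * (logGauge ε * a ε) + 3 * (a ε *
      (1 - Real.eulerMascheroniConstant * logGauge ε + logGauge ε ^ 4 * e ε))) logGauge_pos
    (by
      repeat' first
        | assumption | apply IsBddAlong.const | apply IsBddAlong.pow | apply IsBddAlong.add
        | apply IsBddAlong.sub | apply IsBddAlong.neg | apply IsBddAlong.mul)
    (by
      filter_upwards [hεa, hE, self_mem_nhdsWithin] with ε h1 h2 hε
      refine (abs_expIntJ_sub_le hε).trans (le_of_eq ?_)
      rw [← h2]
      linear_combination (4 + 3 * expIntE1 ε) * h1)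
  obtain ⟨f, hf, hΦ⟩ := exists_isBddAlong_of_abs_le
    (X := fun ε => Φ ε ε - (C ε * expIntG ε - C ε ^ 2 * expIntJ ε)) 3
    (b := fun ε => 3 / 2 * z ε ^ 3) logGauge_pos ((IsBddAlong.const _).mul (hz.pow 3))
    (by
      filter_upwards [hC, self_mem_nhdsWithin] with ε h1 hε
      have hs := h ε hε
      have h2 := hs.le_Φ le_rfl
      have h3 := hs.Φ_le' le_rfl
      have hCp := hs.C_pos
      have h4 : 3 / 2 * C ε ^ 3 * expIntG ε ≤ 3 / 2 * C ε ^ 3 :=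
        mul_le_of_le_one_right (by positivity) (expIntG_le_one hε)
      have h5 : logGauge ε ^ 3 * (3 / 2 * z ε ^ 3) = 3 / 2 * C ε ^ 3 := by
        rw [h1]
        ring
      rw [abs_of_nonneg (by linarith)]
      linarith)
  refine ⟨fun ε => z ε * g ε - logGauge ε * z ε ^ 2 * j ε + f ε, ?_, ?_⟩
  · repeat' first
      | assumption | apply IsBddAlong.const | apply IsBddAlong.pow | apply IsBddAlong.add
      | apply IsBddAlong.sub | apply IsBddAlong.neg | apply IsBddAlong.mul
  · filter_upwards [hC, hG, hJ, hΦ] with ε h1 h2 h3 h4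
    rw [h1] at h4
    linear_combination h4 + logGauge ε * z ε * h2 - logGauge ε ^ 2 * z ε ^ 2 * h3

/-- The coefficient is `3/2 - log 2 = 1/2 + (1 - log 2)`, from `Φ² / 2` and from the second-order
term of `Φ`. -/
theorem exists_exp_neg_Φ_eq (h : ∀ ε, 0 < ε → OuterSystem ε (C ε) (W ε) (Φ ε)) {z : ℝ → ℝ}
    (hz : IsBddAlong (𝓝[>] 0) z) (hC : ∀ᶠ ε in 𝓝[>] (0 : ℝ), C ε = logGauge ε ^ 1 * z ε) :
    ∃ p, IsBddAlong (𝓝[>] 0) p ∧ ∀ᶠ ε in 𝓝[>] (0 : ℝ), Real.exp (-Φ ε ε) =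
      1 - logGauge ε * z ε + (3 / 2 - Real.log 2) * logGauge ε ^ 2 * z ε ^ 2
        + logGauge ε ^ 3 * p ε := by
  have hδb := isBddAlong_logGauge
  obtain ⟨f, hf, hΦ⟩ := exists_Φ_eq h hz hC
  obtain ⟨x, hx, hexp⟩ := exists_isBddAlong_of_abs_le
    (X := fun ε => Real.exp (-Φ ε ε) - (1 - Φ ε ε + Φ ε ε ^ 2 / 2)) 3
    (b := fun ε => z ε ^ 3) logGauge_pos (hz.pow 3)
    (by
      filter_upwards [hC, self_mem_nhdsWithin] with ε h1 hε
      have hs := h ε hε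
      have h0 := hs.Φ_nonneg le_rfl
      refine (abs_exp_neg_sub_quadratic_le h0).trans ?_
      have h2 : Φ ε ε ≤ C ε :=
        (hs.Φ_le le_rfl).trans (mul_le_of_le_one_right hs.C_pos.le (expIntG_le_one hε))
      rw [← mul_pow, ← pow_one (logGauge ε), ← h1]
      exact pow_le_pow_left₀ h0 h2 3)
  -- Chosen so that `Φ(ε) = δ z - δ² m`.
  obtain ⟨m, hm, em⟩ : ∃ m, IsBddAlong (𝓝[>] 0) m ∧
      m = fun ε => (1 - Real.log 2) * z ε ^ 2 - logGauge ε * f ε := by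
    refine ⟨_, ?_, rfl⟩
    repeat' first
      | assumption | apply IsBddAlong.const | apply IsBddAlong.pow | apply IsBddAlong.add
      | apply IsBddAlong.sub | apply IsBddAlong.neg | apply IsBddAlong.mul
  refine ⟨fun ε => -f ε - z ε * m ε + 1 / 2 * (logGauge ε * m ε ^ 2) + x ε, ?_, ?_⟩
  · repeat' first
      | assumption | apply IsBddAlong.const | apply IsBddAlong.pow | apply IsBddAlong.add
      | apply IsBddAlong.sub | apply IsBddAlong.neg | apply IsBddAlong.mul
  · filter_upwards [hΦ, hexp] with ε h1 h2
    have h3 : m ε = _ := congrFun em ε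
    rw [h1] at h2 ⊢
    rw [h3]
    linear_combination h2

theorem exists_C_expansion (h : ∀ ε, 0 < ε → OuterSystem ε (C ε) (W ε) (Φ ε)) :
    ∃ c, IsBddAlong (𝓝[>] 0) c ∧ ∀ᶠ ε in 𝓝[>] (0 : ℝ), C ε =
      logGauge ε * (1 + (Real.eulerMascheroniConstant + 1) * logGauge ε
        + (Real.eulerMascheroniConstant ^ 2 + 2 * Real.eulerMascheroniConstant + 1 / 2
          - Real.log 2) * logGauge ε ^ 2 + logGauge ε ^ 3 * c ε) := by
  have hδb := isBddAlong_logGauge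
  obtain ⟨z, hz, hC⟩ := exists_C_eq h
  obtain ⟨p, hp, hexp⟩ := exists_exp_neg_Φ_eq h hz hC
  obtain ⟨a, ha, hεa⟩ := exists_eq_logGauge_pow
  obtain ⟨e, he, hE⟩ := exists_expIntE1_expansion
  set y : ℝ → ℝ := fun ε =>
    1 - Real.eulerMascheroniConstant * logGauge ε + logGauge ε ^ 4 * e ε with hy
  have hyb : IsBddAlong (𝓝[>] 0) y := by
    repeat' first
      | assumption | apply IsBddAlong.const | apply IsBddAlong.pow | apply IsBddAlong.add
      | apply IsBddAlong.sub | apply IsBddAlong.neg | apply IsBddAlong.mul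
  -- Only first order is available: `ε E₁(ε)²` is `O(δ³ · δ^{-2})`. It suffices because `D` enters
  -- with the factor `C²`.
  obtain ⟨d, hd, hD⟩ := exists_isBddAlong_of_abs_le (X := fun ε => expIntD ε - 2 * Real.log 2) 1
    (b := fun ε => 4 * (logGauge ε ^ 2 * a ε) + 2 * (logGauge ε * a ε * y ε) + a ε * y ε ^ 2)
    logGauge_pos
    (by
      repeat' first
        | assumption | apply IsBddAlong.const | apply IsBddAlong.pow | apply IsBddAlong.add
        | apply IsBddAlong.sub | apply IsBddAlong.neg | apply IsBddAlong.mul)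
    (by
      filter_upwards [hεa, hE, self_mem_nhdsWithin] with ε h1 h2 hε
      refine (abs_expIntD_sub_le hε).trans (le_of_eq ?_)
      have h3 : y ε = logGauge ε * expIntE1 ε := h2.symm
      rw [h3]
      linear_combination (4 + 2 * expIntE1 ε + expIntE1 ε ^ 2) * h1)
  obtain ⟨s, hs, hS⟩ := exists_isBddAlong_of_abs_le
    (X := fun ε => 1 / C ε - expIntE1 ε * Real.exp (-Φ ε ε) - C ε * expIntD ε) 2
    (b := fun ε => 2 * (z ε ^ 2 * (2 * Real.log 2 + logGauge ε * d ε)))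
    logGauge_pos
    (by
      repeat' first
        | assumption | apply IsBddAlong.const | apply IsBddAlong.pow | apply IsBddAlong.add
        | apply IsBddAlong.sub | apply IsBddAlong.neg | apply IsBddAlong.mul)
    (by
      filter_upwards [hC, hD, self_mem_nhdsWithin] with ε h1 h2 hε
      obtain ⟨h3, h4⟩ := (h ε hε).remainder_mem le_rfl
      rw [(h ε hε).W_left] at h3 h4
      rw [abs_of_nonpos (by linarith)]
      have h5 : logGauge ε ^ 2 * (2 * (z ε ^ 2 * (2 * Real.log 2 + logGauge ε * d ε))) =
          2 * C ε ^ 2 * expIntD ε := by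
        rw [h1]
        linear_combination (-2 * logGauge ε ^ 2 * z ε ^ 2) * h2
      linarith)
  have key := exists_expansion Real.eulerMascheroniConstant (Real.log 2) hδb hz
    (b := fun ε => -(z ε * (1 - Real.eulerMascheroniConstant * logGauge ε) * p ε
      + z ε * logGauge ε * e ε * (1 - logGauge ε * z ε
        + (3 / 2 - Real.log 2) * logGauge ε ^ 2 * z ε ^ 2 + logGauge ε ^ 3 * p ε)
      + z ε ^ 2 * d ε + z ε * s ε))
    (by
      repeat' first
        | assumption | apply IsBddAlong.const | apply IsBddAlong.pow | apply IsBddAlong.add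
        | apply IsBddAlong.sub | apply IsBddAlong.neg | apply IsBddAlong.mul)
    (by
      filter_upwards [hC, hexp, hE, hD, hS, self_mem_nhdsWithin] with ε h1 h2 h3 h4 h5 hε
      have hCp := (h ε hε).C_pos
      -- The integrated-by-parts form of `W(ε) = 1`, multiplied by `C`.
      have h6 : 1 = C ε * expIntE1 ε * Real.exp (-Φ ε ε) + C ε * (C ε * expIntD ε)
          + C ε * (logGauge ε ^ 2 * s ε) := by
        rw [← h5]
        field_simp
        ring
      rw [h1, h2] at h6
      linear_combination -h6 - z ε * (1 - logGauge ε * z ε + (3 / 2 - Real.log 2)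
        * logGauge ε ^ 2 * z ε ^ 2 + logGauge ε ^ 3 * p ε) * h3
        - logGauge ε ^ 2 * z ε ^ 2 * h4)
  obtain ⟨c, hc, hzc⟩ := key
  refine ⟨c, hc, ?_⟩
  filter_upwards [hC, hzc] with ε h1 h2
  rw [h1, pow_one, ← h2]

/-- The slope in `log r` is `C e^{-Φ(ε)} = C - C² + O(C³)`; the term `-C²` turns the coefficient `γ
+ 1` of `C` into `γ`. -/
theorem inner_expansion (h : ∀ ε, 0 < ε → OuterSystem ε (C ε) (W ε) (Φ ε)) {r : ℝ} (hr : 1 ≤ r) :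
    ∃ b, IsBddAlong (𝓝[>] 0) b ∧ ∀ᶠ ε in 𝓝[>] (0 : ℝ), 1 - W ε (ε * r) =
      Real.log r * logGauge ε + Real.eulerMascheroniConstant * Real.log r * logGauge ε ^ 2
        + logGauge ε ^ 3 * b ε := by
  have hδb := isBddAlong_logGauge
  obtain ⟨z, hz, hC⟩ := exists_C_eq h
  obtain ⟨p, hp, hexp⟩ := exists_exp_neg_Φ_eq h hz hC
  obtain ⟨c, hc, hCc⟩ := exists_C_expansion h
  obtain ⟨a, ha, hεa⟩ := exists_eq_logGauge_pow
  have hlog : 0 ≤ Real.log r := Real.log_nonneg hr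
  obtain ⟨s, hs, hS⟩ := exists_isBddAlong_of_abs_le
    (X := fun ε => 1 - W ε (ε * r) - C ε * Real.log r * Real.exp (-Φ ε ε)) 4
    (b := fun ε => z ε * Real.log r * (2 * (a ε * r))) logGauge_pos
    (by
      repeat' first
        | assumption | apply IsBddAlong.const | apply IsBddAlong.pow | apply IsBddAlong.add
        | apply IsBddAlong.sub | apply IsBddAlong.neg | apply IsBddAlong.mul)
    (by
      -- With `ε r < 1`, the factors `e^{±ε r}` differ from `1` by at most `2 ε r`.
      have hsmall : Ioo 0 (1 / r) ∈ 𝓝[>] (0 : ℝ) := Ioo_mem_nhdsGT (by positivity)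
      filter_upwards [hC, hεa, hsmall] with ε h1 h2 hε
      have hε0 : 0 < ε := hε.1
      have hεr0 : 0 < ε * r := by positivity
      have hεr : ε * r < 1 := (lt_div_iff₀ (by linarith)).1 hε.2
      obtain ⟨h3, h4⟩ := (h ε hε0).one_sub_W_mem hr
      have hCp := (h ε hε0).C_pos
      have h5 : Real.exp (-Φ ε ε) ≤ 1 := exp_neg_le_one ((h ε hε0).Φ_nonneg le_rfl)
      have h5' := Real.exp_pos (-Φ ε ε)
      have h6 : 1 - ε * r ≤ Real.exp (-(ε * r)) := by linarith [Real.add_one_le_exp (-(ε * r))]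
      have h7 : Real.exp (ε * r) ≤ 1 + 2 * (ε * r) := by
        have := Real.abs_exp_sub_one_le (x := ε * r) (by rw [abs_of_pos hεr0]; exact hεr.le)
        rw [abs_of_pos hεr0] at this
        linarith [le_abs_self (Real.exp (ε * r) - 1)]
      have hCl : 0 ≤ C ε * Real.log r := by positivity
      have h8 : logGauge ε ^ 4 * (z ε * Real.log r * (2 * (a ε * r))) =
          C ε * Real.log r * (2 * (ε * r)) := by
        rw [h1]
        linear_combination (-2 * logGauge ε * z ε * Real.log r * r) * h2
      rw [h8, abs_le]
      have h9 : C ε * Real.log r * (Real.exp (-Φ ε ε) - 2 * (ε * r)) ≤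
          C ε * Real.log r * (Real.exp (-(ε * r)) * Real.exp (-Φ ε ε)) := by
        refine mul_le_mul_of_nonneg_left ?_ hCl
        nlinarith
      have h10 : C ε * Real.log r * (Real.exp (ε * r) * Real.exp (-Φ ε ε)) ≤
          C ε * Real.log r * (Real.exp (-Φ ε ε) + 2 * (ε * r)) := by
        refine mul_le_mul_of_nonneg_left ?_ hCl
        nlinarith
      constructor <;> linarith)
  obtain ⟨k, hk, ek⟩ : ∃ k, IsBddAlong (𝓝[>] 0) k ∧ k = fun ε =>
      Real.eulerMascheroniConstant + 1 + (Real.eulerMascheroniConstant ^ 2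
        + 2 * Real.eulerMascheroniConstant + 1 / 2 - Real.log 2) * logGauge ε
        + logGauge ε ^ 2 * c ε := by
    refine ⟨_, ?_, rfl⟩
    repeat' first
      | assumption | apply IsBddAlong.const | apply IsBddAlong.pow | apply IsBddAlong.add
      | apply IsBddAlong.sub | apply IsBddAlong.neg | apply IsBddAlong.mul
  refine ⟨fun ε => Real.log r * ((Real.eulerMascheroniConstant ^ 2
      + 2 * Real.eulerMascheroniConstant + 1 / 2 - Real.log 2) + logGauge ε * c ε
      - k ε * (2 + logGauge ε * k ε) + z ε * ((3 / 2 - Real.log 2) * z ε ^ 2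
      + logGauge ε * p ε)) + logGauge ε * s ε, ?_, ?_⟩
  · repeat' first
      | assumption | apply IsBddAlong.const | apply IsBddAlong.pow | apply IsBddAlong.add
      | apply IsBddAlong.sub | apply IsBddAlong.neg | apply IsBddAlong.mul
  · filter_upwards [hC, hexp, hCc, hS, logGauge_pos] with ε h1 h2 h3 h4 hδ
    have h5 : k ε = _ := congrFun ek ε
    have h6 : z ε = 1 + logGauge ε * k ε := by
      rw [h1] at h3
      refine mul_left_cancel₀ hδ.ne' ?_
      rw [h5]
      linear_combination h3
    have h7 : C ε * Real.log r * Real.exp (-Φ ε ε) = Real.log r * (logGauge ε * z ε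
        - logGauge ε ^ 2 * z ε ^ 2 + logGauge ε ^ 3 * (z ε * ((3 / 2 - Real.log 2) * z ε ^ 2
        + logGauge ε * p ε))) := by
      rw [h1, h2]
      ring
    rw [h7] at h4
    generalize z ε * ((3 / 2 - Real.log 2) * z ε ^ 2 + logGauge ε * p ε) = t at *
    rw [h6] at h4
    linear_combination h4 + Real.log r * logGauge ε ^ 2 * h5

theorem outer_expansion (h : ∀ ε, 0 < ε → OuterSystem ε (C ε) (W ε) (Φ ε)) {ρ : ℝ} (hρ : 0 < ρ) :
    ∃ b, IsBddAlong (𝓝[>] 0) b ∧ ∀ᶠ ε in 𝓝[>] (0 : ℝ), W ε ρ =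
      expIntE1 ρ * (logGauge ε + (Real.eulerMascheroniConstant + 1) * logGauge ε ^ 2)
        - logGauge ε ^ 2 * expIntH ρ + logGauge ε ^ 3 * b ε := by
  have hδb := isBddAlong_logGauge
  obtain ⟨z, hz, hC⟩ := exists_C_eq h
  obtain ⟨c, hc, hCc⟩ := exists_C_expansion h
  obtain ⟨s, hs, hS⟩ := exists_isBddAlong_of_abs_le
    (X := fun ε => W ε ρ - (C ε * expIntE1 ρ - C ε ^ 2 * expIntH ρ)) 3
    (b := fun ε => 3 / 2 * z ε ^ 3 * expIntE1 ρ) logGauge_pos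
    (by
      repeat' first
        | assumption | apply IsBddAlong.const | apply IsBddAlong.pow | apply IsBddAlong.add
        | apply IsBddAlong.sub | apply IsBddAlong.neg | apply IsBddAlong.mul)
    (by
      -- Once `ε < ρ` the two-sided bounds on `W` apply at `ρ`, where `E₁` and `H` no longer depend
      -- on `ε`.
      filter_upwards [hC, Ioo_mem_nhdsGT hρ] with ε h1 hε
      have h2 := (h ε hε.1).le_W hε.2.le
      have h3 := (h ε hε.1).W_le' hε.2.le
      rw [abs_of_nonneg (by linarith)]
      have h4 : logGauge ε ^ 3 * (3 / 2 * z ε ^ 3 * expIntE1 ρ) =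
          3 / 2 * C ε ^ 3 * expIntE1 ρ := by
        rw [h1]
        ring
      linarith)
  obtain ⟨k, hk, ek⟩ : ∃ k, IsBddAlong (𝓝[>] 0) k ∧ k = fun ε =>
      Real.eulerMascheroniConstant + 1 + logGauge ε * ((Real.eulerMascheroniConstant ^ 2
        + 2 * Real.eulerMascheroniConstant + 1 / 2 - Real.log 2) + logGauge ε * c ε) := by
    refine ⟨_, ?_, rfl⟩
    repeat' first
      | assumption | apply IsBddAlong.const | apply IsBddAlong.pow | apply IsBddAlong.add
      | apply IsBddAlong.sub | apply IsBddAlong.neg | apply IsBddAlong.mul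
  refine ⟨fun ε => expIntE1 ρ * ((Real.eulerMascheroniConstant ^ 2
        + 2 * Real.eulerMascheroniConstant + 1 / 2 - Real.log 2) + logGauge ε * c ε)
        - k ε * (2 + logGauge ε * k ε) * expIntH ρ + s ε, ?_, ?_⟩
  · repeat' first
      | assumption | apply IsBddAlong.const | apply IsBddAlong.pow | apply IsBddAlong.add
      | apply IsBddAlong.sub | apply IsBddAlong.neg | apply IsBddAlong.mul
  · filter_upwards [hCc, hS] with ε h3 h4
    have h5 : k ε = _ := congrFun ek ε
    have h6 : C ε = logGauge ε * (1 + logGauge ε * k ε) := by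
      rw [h5]
      linear_combination h3
    rw [h6] at h4
    linear_combination h4 + logGauge ε ^ 2 * expIntE1 ρ * h5

end Expansion

/-! ### Assembly of the asymptotic statements -/

theorem isBigO_one_div_log_pow {X b : ℝ → ℝ} (n : ℕ) (hb : IsBddAlong (𝓝[>] 0) b)
    (h : ∀ᶠ ε in 𝓝[>] (0 : ℝ), X ε = logGauge ε ^ n * b ε) :
    X =O[𝓝[>] (0 : ℝ)] fun ε : ℝ => 1 / Real.log (1 / ε) ^ n := by
  have h1 : (fun ε => logGauge ε ^ n * b ε) =O[𝓝[>] (0 : ℝ)] fun ε => logGauge ε ^ n * 1 :=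
    (isBigO_refl _ _).mul hb
  refine (h1.congr' (h.mono fun ε hε => hε.symm) (Eventually.of_forall fun ε => ?_))
  simp only [logGauge, mul_one, div_pow, one_pow]

theorem mainTheorem3 (u : ℝ → ℝ → ℝ)
    (hu : ∀ ε : ℝ, 0 < ε → IsLagerstromSolution 2 0 ε (u ε)) :
    ∃ C : ℝ → ℝ,
      (∀ ε : ℝ, 0 < ε → ∀ c : ℝ, IsIntegralEqConstant ε (u ε) c ↔ c = C ε) ∧
      ((fun ε : ℝ => C ε -
          (1 / Real.log (1 / ε)
            + (Real.eulerMascheroniConstant + 1) / Real.log (1 / ε) ^ 2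
            + (Real.eulerMascheroniConstant ^ 2 + 2 * Real.eulerMascheroniConstant
                + 1 / 2 - Real.log 2) / Real.log (1 / ε) ^ 3))
        =O[𝓝[>] (0 : ℝ)] fun ε : ℝ => 1 / Real.log (1 / ε) ^ 4) ∧
      (∀ r : ℝ, 1 ≤ r →
        (fun ε : ℝ => u ε r -
          (Real.log r / Real.log (1 / ε)
            + Real.eulerMascheroniConstant * Real.log r / Real.log (1 / ε) ^ 2))
        =O[𝓝[>] (0 : ℝ)] fun ε : ℝ => 1 / Real.log (1 / ε) ^ 3) ∧
      (∀ ρ : ℝ, 0 < ρ →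
        (fun ε : ℝ => (u ε (ρ / ε) - 1) -
          (-expIntE1 ρ * (1 / Real.log (1 / ε)
              + (Real.eulerMascheroniConstant + 1) / Real.log (1 / ε) ^ 2)
            + 1 / Real.log (1 / ε) ^ 2
              * (2 * expIntE1 (2 * ρ) - Real.exp (-ρ) * expIntE1 ρ)))
        =O[𝓝[>] (0 : ℝ)] fun ε : ℝ => 1 / Real.log (1 / ε) ^ 3) := by
  have hex : ∀ ε, ∃ C, 0 < ε → OuterSystem ε C (fun x => 1 - u ε (x / ε))
      (fun τ => ∫ x in Ioi τ, (1 - u ε (x / ε))) := by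
    intro ε
    by_cases hε : 0 < ε
    · obtain ⟨C, hC⟩ := ((hu ε hε).exists_outerSystem hε).2
      exact ⟨C, fun _ => hC⟩
    -- An arbitrary value for `ε ≤ 0`, so that `C` is a function on all of `ℝ`.
    · exact ⟨0, fun h => absurd h hε⟩
  choose C hC using hex
  refine ⟨C, fun ε hε c =>
    (hC ε hε).isIntegralEqConstant_iff ((hu ε hε).exists_outerSystem hε).1 c, ?_, ?_, ?_⟩
  · obtain ⟨c, hc, hCc⟩ := exists_C_expansion hC
    refine isBigO_one_div_log_pow 4 hc ?_
    filter_upwards [hCc] with ε h1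
    rw [h1, logGauge]
    ring
  · intro r hr
    obtain ⟨b, hb, hW⟩ := inner_expansion hC hr
    refine isBigO_one_div_log_pow 3 hb ?_
    filter_upwards [hW, self_mem_nhdsWithin] with ε h1 hε
    rw [mul_div_cancel_left₀ r (ne_of_gt hε), sub_sub_cancel] at h1
    rw [h1, logGauge]
    ring
  · intro ρ hρ
    obtain ⟨b, hb, hW⟩ := outer_expansion hC hρ
    refine isBigO_one_div_log_pow 3 hb.neg ?_
    filter_upwards [hW] with ε h1
    rw [← neg_sub 1, h1, logGauge, expIntH]
    ring
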